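/- **Theorem (roots).** There are absolute constants $c, C>0$ such that the following holds. Let $a_0,a_1,a_2,\dots$ be independent real random variables on a probability space $(\Omega,\Sigma,\mathbb P)$ with $\mathbb E[a_j]=0$ and $\mathbb E[a_j^2]=1$ for all $j$, and suppose that for some constant $K$ $$\mathcal L(a_j,\varepsilon):=\sup_{t\in\mathbb R}\mathbb P(|a_j-t|<\varepsilon)\le K\varepsilon\qquad\text{for all } j\ge 0 \text{ and all } \varepsilon>0 .$$ Let $f=f_\omega$, $f_\omega(z)=\sum_{j=0}^\infty a_j(\omega)z^j$, be the associated random power series. For $0<r\le 1$ let $\mathfrak N_f(r)\in\{0,1,2,\dots\}\cup\{\infty\}$ be the number of zeros of $f$, counted with multiplicity, in the open disc $\{|z|<r\}$, and for $s=0,1,2,\dots$ let $R_s=R_s(f)$ be the largest $r\in(0,1]$ with $\mathfrak N_f(r)\le s$. Then for almost every $\omega$ the series converges in the unit disc $\mathbb D=\{|z|<1\}$, the numbers $\mathfrak N_f(r)$ for $r<1$, the integrals $\int_0^r \mathfrak N_f(t)\,\frac{dt}{t}$ for $0<r<1$ and the radii $R_s$ are well defined and finite, and: 1. $$\liminf_{r\uparrow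 1}\left|\frac{1}{\log(1-r^2)}\int_0^r\frac{\mathfrak N_f(t)}{t}\,dt+\frac12\right|=0 .$$ 2. $f$ has infinitely many (distinct) zeros in $\mathbb D$; $0<R_s<1$ for every $s\ge 0$; the sequence $(R_s)_{s\ge0}$ is non-decreasing with $R_s\to1$ as $s\to\infty$; and for all sufficiently large $s$ (depending on $\omega$) $$1-R_s\ \ge\ R_0^{\,cs}\qquad\text{and}\qquad 1-R_s\ \le\ C\,\frac{\log s}{s};$$ in particular $1-R_s=O(\log s/s)$ as $s\to\infty$. -/

import Mathlib

open Filter Topology MeasureTheory ProbabilityTheory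

noncomputable section

namespace RandomSeries

/-- The Lévy concentration function `ξ, δ ↦ sup_{t ∈ ℝ} P(|ξ - t| < δ)` of a real random variable. -/
def levyConcentration {Ω : Type*} [MeasurableSpace Ω] (P : Measure Ω) (ξ : Ω → ℝ) (δ : ℝ) :
    ENNReal :=
  ⨆ t : ℝ, P {ω | |ξ ω - t| < δ}

/-- The sum `z ↦ ∑ b_j z^j` of a power series with real coefficients. -/
def seriesSum (b : ℕ → ℝ) (z : ℂ) : ℂ :=
  ∑' j : ℕ, (b j : ℂ) * z ^ j

/-- The number, possibly infinite, of zeros of `f` in the open disc of radius `r` centred at the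
origin, counted with multiplicity: the supremum over all finite sets of points of the disc of the
sum of the orders of vanishing (the order is `0` at a point that is not a zero). It is used for
functions that are holomorphic on the disc. -/
def zeroCount (f : ℂ → ℂ) (r : ℝ) : ℕ∞ :=
  ⨆ S : Finset ℂ, ⨆ _ : (S : Set ℂ) ⊆ Metric.ball 0 r, ∑ z ∈ S, analyticOrderAt f z

/-- The integrated counting function `∫_0^r N_f(t) / t dt`. The conversion to a real number is the
true one as soon as the counts are finite. -/
def integratedCount (f : ℂ → ℂ) (r : ℝ) : ℝ :=
  ∫ t in (0 : ℝ)..r, ((zeroCount f t).toNat : ℝ) / t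

/-- The radii `r` for which `f`, a function on the open unit disc, has at most `s` zeros in the
open disc of radius `r` centred at the origin. -/
def admissibleRadii (f : ℂ → ℂ) (s : ℕ) : Set ℝ :=
  {r : ℝ | 0 < r ∧ r ≤ 1 ∧ zeroCount f r ≤ (s : ℕ∞)}

/-- The largest radius `r` for which `f` has at most `s` zeros in the open disc of radius `r`. -/
def zeroRadius (f : ℂ → ℂ) (s : ℕ) : ℝ :=
  sSup (admissibleRadii f s)

end RandomSeries

end

/-! Write `I(r)` for the integrated count. Jensen's formula says that `I(r)` is the mean of `log
|f|` over the circle of radius `r`, minus `log |f 0|`. Since `E |f(w)|^2 = 1 / (1 - |w|^2)`, one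
expects `log |f(w)|` to be about `-log (1 - |w|^2) / 2`, and the proof shows that the error is
negligible on average over circles.

The error is `log Y` with `Y = √(1 - |w|^2) |f(w)|`. Its second moment is bounded uniformly in `w`
(`lintegral_log_norm_seriesSum_sq_le`): large values of `Y` are controlled by `E Y^2 ≤ 1`, small
ones by `P(Y < v) ≤ 52 K √v` (`measureReal_norm_seriesSum_lt_le`). The latter is a geometric mean of
two bounds: Esseen's inequality at scales at least `4`, and the concentration of `a 0` alone at
small scales.

Along `r_n = √(1 - 2^(-n))`, Tonelli's theorem and the summability of `1 / (n+1)^2` make the mean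
square error on the circle almost surely `o(n^2)` (`ae_tendsto_lintegral`). By Cauchy-Schwarz the
mean error is `o(n)`, so `I(r_n) / n → log 2 / 2`. Monotonicity of `I` fills the gaps and gives the
full limit `I(r) / -log (1 - r^2) → 1/2`, stronger than the liminf in part 1.

Part 2 follows deterministically from this limit. At most `s` zeros below `R_s` and none below `R_0`
bound `I(R_s)` above by `s log (1 / R_0)`; more than `s` zeros just beyond `R_s` force `I` to be
large there. Comparison with `-log (1 - r^2)` gives both estimates. -/

namespace RandomSeries

/-! ### Zero counting and Jensen's formula -/

section Zeros

open Metric Real MeromorphicOn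

variable {f : ℂ → ℂ}

theorem zeroCount_mono (f : ℂ → ℂ) : Monotone (zeroCount f) := by
  intro r t hrt
  refine iSup_le fun S => iSup_le fun hS => ?_
  exact le_iSup₂_of_le (f := fun (S : Finset ℂ) (_ : (S : Set ℂ) ⊆ ball 0 t) =>
    ∑ z ∈ S, analyticOrderAt f z) S (hS.trans (ball_subset_ball hrt)) le_rfl

theorem sum_analyticOrderAt_le_zeroCount {r : ℝ} {S : Finset ℂ} (hS : (S : Set ℂ) ⊆ ball 0 r) :
    ∑ z ∈ S, analyticOrderAt f z ≤ zeroCount f r :=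
  le_iSup₂_of_le (f := fun (S : Finset ℂ) (_ : (S : Set ℂ) ⊆ ball 0 r) =>
    ∑ z ∈ S, analyticOrderAt f z) S hS le_rfl

/-- A zero count on an open disc is at most `s` as soon as it is so on all smaller discs. -/
theorem zeroCount_le_of_forall_lt {r : ℝ} {s : ℕ∞} (h : ∀ t < r, zeroCount f t ≤ s) :
    zeroCount f r ≤ s := by
  refine iSup_le fun S => iSup_le fun hS => ?_
  rcases S.eq_empty_or_nonempty with rfl | hne
  · simp
  · obtain ⟨w, hw, hmax⟩ := S.exists_max_image (fun z => ‖z‖) hne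
    have hwr : ‖w‖ < r := by simpa using hS hw
    obtain ⟨t, hwt, htr⟩ := exists_between hwr
    refine (sum_analyticOrderAt_le_zeroCount (r := t) ?_).trans (h t htr)
    intro z hz
    simpa using (hmax z hz).trans_lt hwt

/-- The zeros in a closed disc inside the unit disc, the counting function expressed through
them, and Jensen's formula. -/
theorem exists_zeros (hf : AnalyticOnNhd ℂ f (ball 0 1)) (h0 : f 0 ≠ 0) {r : ℝ} (hr0 : 0 < r)
    (hr1 : r < 1) :
    ∃ (Z : Finset ℂ) (m : ℂ → ℕ), (∀ z ∈ Z, 0 < ‖z‖ ∧ ‖z‖ ≤ r) ∧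
      (∀ t ≤ r, zeroCount f t = ((∑ z ∈ Z, if ‖z‖ < t then m z else 0 : ℕ) : ℕ∞)) ∧
      circleAverage (fun z => log ‖f z‖) 0 r =
        ∑ z ∈ Z, (m z : ℝ) * log (r * ‖z‖⁻¹) + log ‖f 0‖ := by
  have hCB : closedBall (0 : ℂ) r ⊆ ball 0 1 := closedBall_subset_ball hr1
  have hfr : AnalyticOnNhd ℂ f (closedBall 0 r) := hf.mono hCB
  -- Since `f 0 ≠ 0`, the identity theorem on the connected disc excludes zeros of infinite order.
  have htop : ∀ z ∈ ball (0 : ℂ) 1, analyticOrderAt f z ≠ ⊤ := fun z hz =>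
    hf.analyticOrderAt_ne_top_of_isPreconnected (convex_ball 0 1).isPreconnected
      (x := 0) (by simp) hz (by rw [(hf 0 (by simp)).analyticOrderAt_eq_zero.mpr h0]; simp)
  have hfin := (divisor f (closedBall (0 : ℂ) r)).finiteSupport (isCompact_closedBall 0 r)
  have hdiv : ∀ z ∈ closedBall (0 : ℂ) r,
      divisor f (closedBall (0 : ℂ) r) z = (analyticOrderNatAt f z : ℤ) := fun z hz => by
    rw [hfr.divisor_apply hz, ← Nat.cast_analyticOrderNatAt (htop z (hCB hz))]
    rfl
  have hmem : ∀ z ∈ hfin.toFinset, z ∈ closedBall (0 : ℂ) r := fun z hz =>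
    (divisor f (closedBall (0 : ℂ) r)).supportWithinDomain (by simpa using hz)
  refine ⟨hfin.toFinset, analyticOrderNatAt f, ?_, ?_, ?_⟩
  · intro z hz
    refine ⟨norm_pos_iff.mpr ?_, by simpa using hmem z hz⟩
    rintro rfl
    have : divisor f (closedBall (0 : ℂ) r) 0 ≠ 0 := by simpa using hz
    rw [hdiv 0 (by simpa using hr0.le)] at this
    refine this ?_
    simp [analyticOrderNatAt, (hf 0 (by simp)).analyticOrderAt_eq_zero.mpr h0]
  · intro t htr
    have hball : ball (0 : ℂ) t ⊆ closedBall 0 r :=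
      (ball_subset_ball htr).trans ball_subset_closedBall
    have key : ((∑ z ∈ hfin.toFinset, if ‖z‖ < t then analyticOrderNatAt f z else 0 : ℕ) : ℕ∞)
        = ∑ z ∈ hfin.toFinset with ‖z‖ < t, analyticOrderAt f z := by
      rw [Finset.sum_ite, Finset.sum_const_zero, add_zero, Nat.cast_sum]
      refine Finset.sum_congr rfl fun z hz => ?_
      exact Nat.cast_analyticOrderNatAt (htop z (hCB (hmem z (Finset.mem_filter.1 hz).1)))
    rw [key]
    apply le_antisymm
    · refine iSup_le fun S => iSup_le fun hS => ?_
      refine Finset.sum_le_sum_of_ne_zero fun z hz hne => ?_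
      have hzt := hS hz
      rw [Finset.mem_filter]
      refine ⟨?_, by simpa using hzt⟩
      have := hdiv z (hball hzt)
      simp only [Set.Finite.mem_toFinset, Function.mem_support]
      rw [this]
      intro h
      apply hne
      rw [← Nat.cast_analyticOrderNatAt (htop z (hCB (hball hzt)))]
      exact_mod_cast h
    · apply sum_analyticOrderAt_le_zeroCount
      intro z hz
      simpa using (Finset.mem_filter.1 (Finset.mem_coe.1 hz)).2
  · have hJ := AnalyticOnNhd.circleAverage_log_norm (c := 0) (R := r) (f := f) hr0.ne'
      (by rwa [abs_of_pos hr0]) h0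
    rw [hJ, abs_of_pos hr0]
    congr 1
    rw [finsum_eq_sum_of_support_subset (s := hfin.toFinset)]
    · refine Finset.sum_congr rfl fun z hz => ?_
      rw [hdiv z (hmem z hz)]
      simp
    · intro z hz
      simp only [Function.mem_support] at hz
      simp only [Set.Finite.coe_toFinset, Function.mem_support]
      intro h
      simp [h] at hz

/-- The contribution of one zero of modulus `ρ` and multiplicity `m`; it matches that zero's term in
Jensen's formula. -/
theorem integral_indicator_div {r ρ : ℝ} (hρ : 0 < ρ) (hρr : ρ ≤ r) (m : ℕ) :
    IntervalIntegrable (fun t : ℝ => ((if ρ < t then m else 0 : ℕ) : ℝ) / t) volume 0 r ∧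
      ∫ t in (0 : ℝ)..r, ((if ρ < t then m else 0 : ℕ) : ℝ) / t = m * log (r * ρ⁻¹) := by
  have e1 : Set.EqOn (fun t : ℝ => ((if ρ < t then m else 0 : ℕ) : ℝ) / t) (fun _ => 0)
      (Set.uIoc 0 ρ) := by
    intro t ht
    rw [Set.uIoc_of_le hρ.le] at ht
    simp [not_lt.2 ht.2]
  have e2 : Set.EqOn (fun t : ℝ => ((if ρ < t then m else 0 : ℕ) : ℝ) / t) (fun t => m * t⁻¹)
      (Set.uIoc ρ r) := by
    intro t ht
    rw [Set.uIoc_of_le hρr] at ht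
    simp [ht.1, div_eq_mul_inv]
  have h0 : (0 : ℝ) ∉ Set.uIcc ρ r := by
    rw [Set.uIcc_of_le hρr]; exact fun h => absurd h.1 (not_le.2 hρ)
  have i1 : IntervalIntegrable (fun t : ℝ => ((if ρ < t then m else 0 : ℕ) : ℝ) / t) volume 0 ρ :=
    (intervalIntegrable_const (c := (0 : ℝ))).congr e1.symm
  have i2 : IntervalIntegrable (fun t : ℝ => ((if ρ < t then m else 0 : ℕ) : ℝ) / t) volume ρ r :=
    IntervalIntegrable.congr e2.symm
      ((intervalIntegral.intervalIntegrable_inv (f := fun t => t)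
        (fun x hx h => h0 (h ▸ hx)) continuousOn_id).const_mul _)
  refine ⟨i1.trans i2, ?_⟩
  rw [← intervalIntegral.integral_add_adjacent_intervals i1 i2,
    intervalIntegral.integral_congr_ae (ae_of_all _ fun t ht => e1 ht),
    intervalIntegral.integral_congr_ae (ae_of_all _ fun t ht => e2 ht)]
  simp [integral_inv h0, div_eq_mul_inv]

theorem zeroCount_ne_top (hf : AnalyticOnNhd ℂ f (ball 0 1)) (h0 : f 0 ≠ 0) {r : ℝ}
    (hr1 : r < 1) : zeroCount f r ≠ ⊤ := by
  obtain ⟨t, hrt, ht1⟩ := exists_between (max_lt hr1 one_pos)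
  obtain ⟨Z, m, -, hZ, -⟩ := exists_zeros hf h0 ((le_max_right r 0).trans_lt hrt) ht1
  rw [hZ r ((le_max_left r 0).trans hrt.le)]
  exact ENat.natCast_ne_top _

theorem intervalIntegrable_and_integratedCount_eq (hf : AnalyticOnNhd ℂ f (ball 0 1))
    (h0 : f 0 ≠ 0) {r : ℝ} (hr0 : 0 < r) (hr1 : r < 1) :
    IntervalIntegrable (fun t : ℝ => ((zeroCount f t).toNat : ℝ) / t) volume 0 r ∧
      integratedCount f r = circleAverage (fun z => log ‖f z‖) 0 r - log ‖f 0‖ := by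
  obtain ⟨Z, m, hm, hZ, hJ⟩ := exists_zeros hf h0 hr0 hr1
  have e : Set.EqOn (fun t : ℝ => ((zeroCount f t).toNat : ℝ) / t)
      (fun t => ∑ z ∈ Z, ((if ‖z‖ < t then m z else 0 : ℕ) : ℝ) / t) (Set.uIoc 0 r) := by
    intro t ht
    rw [Set.uIoc_of_le hr0.le] at ht
    simp only [hZ t ht.2, ENat.toNat_natCast]
    rw [Nat.cast_sum, Finset.sum_div]
  have hi := fun z hz => integral_indicator_div (hm z hz).1 (hm z hz).2 (m z)
  constructor
  · refine (IntervalIntegrable.sum Z fun z hz => (hi z hz).1).congr fun t ht => ?_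
    exact (Finset.sum_apply t Z _).trans (e ht).symm
  · rw [hJ, add_sub_cancel_right, integratedCount,
      intervalIntegral.integral_congr_ae (ae_of_all _ fun t ht => e ht),
      intervalIntegral.integral_finsetSum fun z hz => (hi z hz).1]
    exact Finset.sum_congr rfl fun z hz => (hi z hz).2

theorem exists_zeroCount_eq_zero (hf : AnalyticOnNhd ℂ f (ball 0 1)) (h0 : f 0 ≠ 0) :
    ∃ r : ℝ, 0 < r ∧ r < 1 ∧ zeroCount f r = 0 := by
  obtain ⟨Z, m, hm, hZ, -⟩ := exists_zeros hf h0 (r := 1 / 2) (by norm_num) (by norm_num)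
  have : ∃ r : ℝ, 0 < r ∧ r < 1 / 2 ∧ ∀ z ∈ Z, r < ‖z‖ := by
    have : ∀ᶠ r : ℝ in 𝓝[>] 0, 0 < r ∧ r < 1 / 2 ∧ ∀ z ∈ Z, r < ‖z‖ := by
      refine (eventually_mem_nhdsWithin).and (Eventually.filter_mono nhdsWithin_le_nhds ?_)
      refine (gt_mem_nhds (by norm_num)).and ?_
      exact (Z.eventually_all).2 fun z hz => gt_mem_nhds (hm z hz).1
    exact this.exists
  obtain ⟨r, hr, hr2, h⟩ := this
  refine ⟨r, hr, by linarith, ?_⟩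
  rw [hZ r hr2.le, Finset.sum_eq_zero fun z hz => if_neg (h z hz).not_gt]
  rfl

theorem isGreatest_zeroRadius (hf : AnalyticOnNhd ℂ f (ball 0 1)) (h0 : f 0 ≠ 0) (s : ℕ) :
    IsGreatest (admissibleRadii f s) (zeroRadius f s) := by
  obtain ⟨r, hr0, hr1, hr⟩ := exists_zeroCount_eq_zero hf h0
  have hne : r ∈ admissibleRadii f s := ⟨hr0, hr1.le, by simp [hr]⟩
  have hbdd : BddAbove (admissibleRadii f s) := ⟨1, fun t ht => ht.2.1⟩
  refine ⟨⟨hr0.trans_le (le_csSup hbdd hne), csSup_le ⟨r, hne⟩ fun t ht => ht.2.1, ?_⟩,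
    fun t ht => le_csSup hbdd ht⟩
  -- The supremum is attained because the discs are open: the count is continuous from the left.
  refine zeroCount_le_of_forall_lt fun t ht => ?_
  obtain ⟨u, hu, htu⟩ := exists_lt_of_lt_csSup ⟨r, hne⟩ ht
  exact (zeroCount_mono f htu.le).trans hu.2.2

end Zeros

end RandomSeries

namespace RandomSeries

/-! ### From the growth of the integrated count to the zero radii -/

section Deterministic

open Metric Real

variable {f : ℂ → ℂ}

theorem integratedCount_mono (hf : AnalyticOnNhd ℂ f (ball 0 1)) (h0 : f 0 ≠ 0) {r t : ℝ}
    (hr : 0 < r) (hrt : r ≤ t) (ht : t < 1) : integratedCount f r ≤ integratedCount f t := by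
  refine intervalIntegral.integral_mono_interval le_rfl hr.le hrt ?_
    (intervalIntegrable_and_integratedCount_eq hf h0 (hr.trans_le hrt) ht).1
  filter_upwards [ae_restrict_mem measurableSet_Ioc] with u hu
  exact div_nonneg (Nat.cast_nonneg _) hu.1.le

theorem integratedCount_nonneg {r : ℝ} (hr : 0 < r) : 0 ≤ integratedCount f r :=
  intervalIntegral.integral_nonneg hr.le fun _ hu => div_nonneg (Nat.cast_nonneg _) hu.1

/-- If `f` has no zero in the disc of radius `ρ` and at most `s` zeros in the disc of radius `r`,
then its integrated counting function at `r` is at most `s * log (1 / ρ)`. -/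
theorem integratedCount_le (hf : AnalyticOnNhd ℂ f (ball 0 1)) (h0 : f 0 ≠ 0) {ρ r : ℝ} {s : ℕ}
    (hρ : 0 < ρ) (hρr : ρ ≤ r) (hr : r < 1) (hNρ : zeroCount f ρ = 0) (hNr : zeroCount f r ≤ s) :
    integratedCount f r ≤ s * -log ρ := by
  have hi := (intervalIntegrable_and_integratedCount_eq hf h0 (hρ.trans_le hρr) hr).1
  have h1 : IntervalIntegrable (fun t : ℝ => ((zeroCount f t).toNat : ℝ) / t) volume 0 ρ :=
    hi.mono_set (Set.uIcc_subset_uIcc_left (by rw [Set.uIcc_of_le (hρ.le.trans hρr)]; exact ⟨hρ.le, hρr⟩))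
  have h2 : IntervalIntegrable (fun t : ℝ => ((zeroCount f t).toNat : ℝ) / t) volume ρ r :=
    hi.mono_set (Set.uIcc_subset_uIcc_right (by rw [Set.uIcc_of_le (hρ.le.trans hρr)]; exact ⟨hρ.le, hρr⟩))
  have h00 : (0 : ℝ) ∉ Set.uIcc ρ r := by
    rw [Set.uIcc_of_le hρr]; exact fun h => absurd h.1 (not_le.2 hρ)
  have e1 : ∫ t in (0 : ℝ)..ρ, ((zeroCount f t).toNat : ℝ) / t = 0 := by
    rw [intervalIntegral.integral_congr_ae (g := fun _ => (0 : ℝ)), intervalIntegral.integral_zero]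
    refine ae_of_all _ fun t ht => ?_
    rw [Set.uIoc_of_le hρ.le] at ht
    have : zeroCount f t = 0 := le_antisymm (hNρ ▸ zeroCount_mono f ht.2) zero_le
    simp [this]
  rw [integratedCount, ← intervalIntegral.integral_add_adjacent_intervals h1 h2, e1, zero_add]
  calc ∫ t in ρ..r, ((zeroCount f t).toNat : ℝ) / t ≤ ∫ t in ρ..r, (s : ℝ) * t⁻¹ := by
        refine intervalIntegral.integral_mono_on hρr h2
          ((intervalIntegral.intervalIntegrable_inv (f := fun t => t)
            (fun x hx h => h00 (h ▸ hx)) continuousOn_id).const_mul _) fun t ht => ?_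
        rw [div_eq_mul_inv]
        have : (zeroCount f t).toNat ≤ s := by
          have := ENat.toNat_le_toNat ((zeroCount_mono f ht.2).trans hNr) (ENat.natCast_ne_top s)
          simpa using this
        have ht0 : 0 ≤ t⁻¹ := inv_nonneg.2 (hρ.le.trans ht.1)
        gcongr
    _ = s * log (r / ρ) := by rw [intervalIntegral.integral_const_mul, integral_inv h00]
    _ ≤ s * -log ρ := by
        rw [log_div (hρ.trans_le hρr).ne' hρ.ne']
        have := log_nonpos (hρ.le.trans hρr) hr.le
        gcongr
        linarith

/-- If `f` has more than `s` zeros in the disc of radius `ρ`, then its integrated counting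
function at `r` is at least `s * (r - ρ)`. -/
theorem le_integratedCount (hf : AnalyticOnNhd ℂ f (ball 0 1)) (h0 : f 0 ≠ 0) {ρ r : ℝ} {s : ℕ}
    (hρ : 0 < ρ) (hρr : ρ ≤ r) (hr : r < 1) (hNρ : (s : ℕ∞) ≤ zeroCount f ρ) :
    s * (r - ρ) ≤ integratedCount f r := by
  have hi := (intervalIntegrable_and_integratedCount_eq hf h0 (hρ.trans_le hρr) hr).1
  have h2 : IntervalIntegrable (fun t : ℝ => ((zeroCount f t).toNat : ℝ) / t) volume ρ r :=
    hi.mono_set (Set.uIcc_subset_uIcc_right (by rw [Set.uIcc_of_le (hρ.le.trans hρr)]; exact ⟨hρ.le, hρr⟩))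
  calc (s : ℝ) * (r - ρ) = ∫ t in ρ..r, (s : ℝ) := by simp [mul_comm]
    _ ≤ ∫ t in ρ..r, ((zeroCount f t).toNat : ℝ) / t := by
        refine intervalIntegral.integral_mono_on hρr intervalIntegrable_const h2 fun t ht => ?_
        have ht0 : 0 < t := hρ.trans_le ht.1
        have h1 : s ≤ (zeroCount f t).toNat := by
          have := ENat.toNat_le_toNat (hNρ.trans (zeroCount_mono f ht.1))
            (zeroCount_ne_top hf h0 (ht.2.trans_lt hr))
          simpa using this
        rw [le_div_iff₀ ht0]
        have h1' : (s : ℝ) ≤ (zeroCount f t).toNat := by exact_mod_cast h1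
        -- As `t < 1`, the weight `1 / t` only helps.
        nlinarith [ht.2, (Nat.cast_nonneg s : (0 : ℝ) ≤ s)]
    _ ≤ integratedCount f r := by
        refine intervalIntegral.integral_mono_interval hρ.le hρr le_rfl ?_ hi
        filter_upwards [ae_restrict_mem measurableSet_Ioc] with u hu
        exact div_nonneg (Nat.cast_nonneg _) hu.1.le

theorem zeroRadius_mono (hf : AnalyticOnNhd ℂ f (ball 0 1)) (h0 : f 0 ≠ 0) :
    Monotone (zeroRadius f) := by
  intro s t hst
  have hs := (isGreatest_zeroRadius hf h0 s).1
  exact (isGreatest_zeroRadius hf h0 t).2 ⟨hs.1, hs.2.1, hs.2.2.trans (by exact_mod_cast hst)⟩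

theorem tendsto_zeroRadius (hf : AnalyticOnNhd ℂ f (ball 0 1)) (h0 : f 0 ≠ 0) :
    Tendsto (zeroRadius f) atTop (𝓝 1) := by
  refine tendsto_order.2 ⟨fun r hr => ?_, fun r hr => ?_⟩
  · obtain ⟨t, hrt, ht1⟩ := exists_between (max_lt hr one_pos)
    have ht0 := (le_max_right r 0).trans_lt hrt
    obtain ⟨n, hn⟩ := ENat.ne_top_iff_exists.1 (zeroCount_ne_top hf h0 ht1)
    filter_upwards [eventually_ge_atTop n] with s hs
    refine ((le_max_left r 0).trans_lt hrt).trans_le ((isGreatest_zeroRadius hf h0 s).2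
      ⟨ht0, ht1.le, ?_⟩)
    rw [← hn]
    exact_mod_cast hs
  · exact Eventually.of_forall fun s => (isGreatest_zeroRadius hf h0 s).1.2.1.trans_lt hr

theorem tendsto_neg_log_one_sub_sq :
    Tendsto (fun r : ℝ => -log (1 - r ^ 2)) (𝓝[<] 1) atTop := by
  refine tendsto_neg_atBot_atTop.comp (tendsto_log_nhdsGT_zero.comp ?_)
  refine tendsto_nhdsWithin_iff.2 ⟨?_, ?_⟩
  · have : ContinuousAt (fun r : ℝ => 1 - r ^ 2) 1 := by fun_prop
    have h := this.tendsto
    norm_num at h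
    exact h.mono_left nhdsWithin_le_nhds
  · have : ∀ᶠ r : ℝ in 𝓝[<] 1, -1 < r := nhdsWithin_le_nhds (lt_mem_nhds (by norm_num))
    filter_upwards [self_mem_nhdsWithin, this] with r hr hr'
    simp only [Set.mem_Iio] at hr
    simp only [Set.mem_Ioi]
    nlinarith

/-- With `n = ⌊log₂ (1 / (1 - r^2))⌋`, the radius `r` lies between the radii of index `n` and `n +
1`. The integrated count is monotone and `(n + 1) / n → 1`, so both ends of the sandwich have the
same limit. -/
theorem tendsto_integratedCount_div_of_sequence (hf : AnalyticOnNhd ℂ f (ball 0 1)) (h0 : f 0 ≠ 0)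
    (h : Tendsto (fun n : ℕ => integratedCount f √(1 - (1 / 2) ^ n) / (n : ℝ)) atTop
      (𝓝 (log 2 / 2))) :
    Tendsto (fun r => integratedCount f r / -log (1 - r ^ 2)) (𝓝[<] 1) (𝓝 (1 / 2)) := by
  have l2 : 0 < log 2 := log_pos one_lt_two
  set u : ℝ → ℕ := fun r => ⌊-log (1 - r ^ 2) / log 2⌋₊ with hu
  have hut : Tendsto u (𝓝[<] 1) atTop :=
    tendsto_nat_floor_atTop.comp (tendsto_neg_log_one_sub_sq.atTop_div_const l2)
  set J : ℕ → ℝ := fun n => integratedCount f √(1 - (1 / 2) ^ n) with hJ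
  have hlow : Tendsto (fun n : ℕ => J n / (((n : ℝ) + 1) * log 2)) atTop (𝓝 (1 / 2)) := by
    have h1 := (h.mul (tendsto_natCast_div_add_atTop (1 : ℝ))).div_const (log 2)
    have e : log 2 / 2 * 1 / log 2 = 1 / 2 := by field_simp
    rw [e] at h1
    refine h1.congr' ?_
    filter_upwards [eventually_gt_atTop 0] with n hn
    have : (0 : ℝ) < n := by exact_mod_cast hn
    simp only [hJ]
    field_simp
  have hhigh : Tendsto (fun n : ℕ => J (n + 1) / ((n : ℝ) * log 2)) atTop (𝓝 (1 / 2)) := by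
    have h2 : Tendsto (fun n : ℕ => ((n : ℝ) / (n + 1))⁻¹) atTop (𝓝 1) := by
      simpa using (tendsto_natCast_div_add_atTop (1 : ℝ)).inv₀ (one_ne_zero (α := ℝ))
    have h1 := (((tendsto_add_atTop_iff_nat 1).2 h).mul h2).div_const (log 2)
    have e : log 2 / 2 * 1 / log 2 = 1 / 2 := by field_simp
    rw [e] at h1
    refine h1.congr' ?_
    filter_upwards [eventually_gt_atTop 0] with n hn
    have : (0 : ℝ) < n := by exact_mod_cast hn
    simp only [hJ]
    push_cast
    field_simp
  have hev : ∀ᶠ r : ℝ in 𝓝[<] 1, 0 < r ∧ r < 1 ∧ 1 ≤ u r := by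
    refine (Eventually.filter_mono nhdsWithin_le_nhds (lt_mem_nhds one_pos)).and
      ((eventually_mem_nhdsWithin).and (hut.eventually (eventually_ge_atTop 1)))
  have hsqrt : ∀ n : ℕ, √(1 - (1 / 2 : ℝ) ^ n) < 1 := fun n => by
    rw [sqrt_lt' one_pos]
    have : (0 : ℝ) < (1 / 2) ^ n := by positivity
    linarith
  have hexp : ∀ n : ℕ, (1 / 2 : ℝ) ^ n = exp (-(n * log 2)) := fun n => by
    rw [exp_neg, mul_comm, exp_mul, exp_log two_pos, rpow_natCast, one_div, inv_pow]
  refine tendsto_of_tendsto_of_tendsto_of_le_of_le' (hlow.comp hut) (hhigh.comp hut) ?_ ?_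
  · filter_upwards [hev] with r ⟨hr0, hr1, hn⟩
    have hpos : 0 < 1 - r ^ 2 := by nlinarith
    have hlt := Nat.lt_floor_add_one (-log (1 - r ^ 2) / log 2)
    have hle := Nat.floor_le (a := -log (1 - r ^ 2) / log 2)
      (div_nonneg (neg_nonneg.2 (log_nonpos hpos.le (by nlinarith))) l2.le)
    change _ < (u r : ℝ) + 1 at hlt
    change (u r : ℝ) ≤ _ at hle
    rw [div_lt_iff₀ l2] at hlt
    rw [le_div_iff₀ l2] at hle
    have hn' : (1 : ℝ) ≤ u r := by exact_mod_cast hn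
    have hL : 0 < -log (1 - r ^ 2) := by nlinarith
    have hrn : √(1 - (1 / 2) ^ (u r)) ≤ r := by
      rw [sqrt_le_left hr0.le, hexp]
      have h3 : 1 - r ^ 2 ≤ exp (-((u r : ℝ) * log 2)) := by
        rw [← log_le_iff_le_exp hpos]; linarith
      linarith
    have hpos' : 0 < √(1 - (1 / 2 : ℝ) ^ (u r)) := by
      rw [sqrt_pos, sub_pos]
      exact pow_lt_one₀ (by norm_num) (by norm_num) (by omega)
    exact div_le_div₀ (integratedCount_nonneg hr0) (integratedCount_mono hf h0 hpos' hrn hr1)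
      hL hlt.le
  · filter_upwards [hev] with r ⟨hr0, hr1, hn⟩
    have hpos : 0 < 1 - r ^ 2 := by nlinarith
    have hlt := Nat.lt_floor_add_one (-log (1 - r ^ 2) / log 2)
    have hle := Nat.floor_le (a := -log (1 - r ^ 2) / log 2)
      (div_nonneg (neg_nonneg.2 (log_nonpos hpos.le (by nlinarith))) l2.le)
    change _ < (u r : ℝ) + 1 at hlt
    change (u r : ℝ) ≤ _ at hle
    rw [div_lt_iff₀ l2] at hlt
    rw [le_div_iff₀ l2] at hle
    have hn' : (1 : ℝ) ≤ u r := by exact_mod_cast hn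
    have hrn : r ≤ √(1 - (1 / 2) ^ (u r + 1)) := by
      rw [le_sqrt' hr0, hexp]
      have h3 : exp (-(((u r + 1 : ℕ) : ℝ) * log 2)) ≤ 1 - r ^ 2 := by
        rw [← le_log_iff_exp_le hpos]; push_cast; linarith
      linarith
    exact div_le_div₀ (integratedCount_nonneg (hr0.trans_le hrn))
      (integratedCount_mono hf h0 hr0 hrn (hsqrt _)) (by positivity) hle

/-- The liminf is taken in `EReal`, a complete lattice, so no default value for unbounded families
can enter. -/
theorem liminf_eq_zero_of_tendsto
    (h : Tendsto (fun r => integratedCount f r / -log (1 - r ^ 2)) (𝓝[<] 1) (𝓝 (1 / 2))) :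
    liminf (fun r : ℝ => ((|1 / log (1 - r ^ 2) * integratedCount f r + 1 / 2| : ℝ) : EReal))
      (𝓝[<] (1 : ℝ)) = 0 := by
  refine Tendsto.liminf_eq ?_
  have h1 := ((h.neg.add_const (1 / 2)).abs)
  rw [neg_add_cancel, abs_zero] at h1
  refine (continuous_coe_real_ereal.tendsto 0).comp (h1.congr fun r => ?_)
  congr 2
  rw [div_neg, neg_neg]
  ring

theorem eventually_le_integratedCount
    (h : Tendsto (fun r => integratedCount f r / -log (1 - r ^ 2)) (𝓝[<] 1) (𝓝 (1 / 2))) :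
    ∀ᶠ r in 𝓝[<] (1 : ℝ), -log (1 - r ^ 2) ≤ 4 * integratedCount f r ∧
      integratedCount f r ≤ -log (1 - r ^ 2) := by
  filter_upwards [h.eventually (lt_mem_nhds (show (1 / 4 : ℝ) < 1 / 2 by norm_num)),
    h.eventually (gt_mem_nhds (show (1 / 2 : ℝ) < 1 by norm_num)),
    tendsto_neg_log_one_sub_sq.eventually (eventually_gt_atTop 0)] with r h1 h2 h3
  rw [lt_div_iff₀ h3] at h1
  rw [div_lt_iff₀ h3] at h2
  constructor <;> linarith

/-- Finitely many zeros would keep the integrated count bounded, whereas it grows like `-log (1 -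
r^2) / 2`. -/
theorem zeroCount_one_eq_top (hf : AnalyticOnNhd ℂ f (ball 0 1)) (h0 : f 0 ≠ 0)
    (h : Tendsto (fun r => integratedCount f r / -log (1 - r ^ 2)) (𝓝[<] 1) (𝓝 (1 / 2))) :
    zeroCount f 1 = ⊤ := by
  by_contra hne
  obtain ⟨M, hM⟩ := ENat.ne_top_iff_exists.1 hne
  obtain ⟨ρ, hρ0, hρ1, hρ⟩ := exists_zeroCount_eq_zero hf h0
  have h1 := tendsto_neg_log_one_sub_sq.eventually (eventually_gt_atTop (4 * (M * -log ρ)))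
  have h2 : ∀ᶠ r : ℝ in 𝓝[<] 1, ρ < r := nhdsWithin_le_nhds (lt_mem_nhds hρ1)
  obtain ⟨r, hr1, hr2, hr3, hr4⟩ :=
    (h1.and (h2.and ((eventually_le_integratedCount h).and self_mem_nhdsWithin))).exists
  have := integratedCount_le hf h0 hρ0 hr2.le hr4 hρ (s := M)
    (hM ▸ zeroCount_mono f (le_of_lt hr4))
  linarith [hr3.1]

theorem infinite_zeros (hf : AnalyticOnNhd ℂ f (ball 0 1)) (h0 : f 0 ≠ 0)
    (h : zeroCount f 1 = ⊤) : {z : ℂ | ‖z‖ < 1 ∧ f z = 0}.Infinite := by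
  intro hfin
  have htop : ∀ z ∈ ball (0 : ℂ) 1, analyticOrderAt f z ≠ ⊤ := fun z hz =>
    hf.analyticOrderAt_ne_top_of_isPreconnected (convex_ball 0 1).isPreconnected
      (x := 0) (by simp) hz (by rw [(hf 0 (by simp)).analyticOrderAt_eq_zero.mpr h0]; simp)
  have hle : zeroCount f 1 ≤ ∑ z ∈ hfin.toFinset, analyticOrderAt f z := by
    refine iSup_le fun S => iSup_le fun hS => ?_
    refine Finset.sum_le_sum_of_ne_zero fun z hz hne => ?_
    simpa using ⟨by simpa using hS hz, apply_eq_zero_of_analyticOrderAt_ne_zero hne⟩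
  rw [h, top_le_iff, ENat.sum_eq_top] at hle
  obtain ⟨z, hz, hzt⟩ := hle
  exact htop z (by simpa using ((Set.Finite.mem_toFinset hfin).1 hz).1) hzt

theorem zeroRadius_lt_one (hf : AnalyticOnNhd ℂ f (ball 0 1)) (h0 : f 0 ≠ 0)
    (h : zeroCount f 1 = ⊤) (s : ℕ) : zeroRadius f s < 1 := by
  have hs := (isGreatest_zeroRadius hf h0 s).1
  refine lt_of_le_of_ne hs.2.1 fun he => ?_
  have := hs.2.2
  rw [he, h] at this
  exact ENat.natCast_ne_top s (top_le_iff.1 this)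

theorem tendsto_zeroRadius_nhdsLT (hf : AnalyticOnNhd ℂ f (ball 0 1)) (h0 : f 0 ≠ 0)
    (h : zeroCount f 1 = ⊤) : Tendsto (zeroRadius f) atTop (𝓝[<] 1) :=
  tendsto_nhdsWithin_iff.2
    ⟨tendsto_zeroRadius hf h0, Eventually.of_forall fun s => zeroRadius_lt_one hf h0 h s⟩

/-- At `r = R_s`, `-log (1 - r^2) ≤ 4 I(r) ≤ 4 s log (1 / R_0)`, that is, `R_0^(4s) ≤ 1 - r^2 ≤ 2 (1
- r)`. -/
theorem eventually_rpow_le_one_sub_zeroRadius (hf : AnalyticOnNhd ℂ f (ball 0 1)) (h0 : f 0 ≠ 0)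
    (h : Tendsto (fun r => integratedCount f r / -log (1 - r ^ 2)) (𝓝[<] 1) (𝓝 (1 / 2))) :
    ∀ᶠ s : ℕ in atTop, zeroRadius f 0 ^ ((5 : ℝ) * (s : ℝ)) ≤ 1 - zeroRadius f s := by
  have htop := zeroCount_one_eq_top hf h0 h
  have hR0 := (isGreatest_zeroRadius hf h0 0).1
  have hR01 := zeroRadius_lt_one hf h0 htop 0
  set ρ := zeroRadius f 0
  have hlρ : log ρ < 0 := log_neg hR0.1 hR01
  -- The fifth factor `ρ ^ s` absorbs the `2` in `1 - r^2 ≤ 2 (1 - r)`; hence the exponent `5 s`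
  -- rather than `4 s`.
  have hpow : ∀ᶠ s : ℕ in atTop, ρ ^ s ≤ 1 / 2 :=
    ((tendsto_pow_atTop_nhds_zero_of_lt_one hR0.1.le hR01).eventually
      (gt_mem_nhds (by norm_num : (0 : ℝ) < 1 / 2))).mono fun s hs => hs.le
  filter_upwards [(tendsto_zeroRadius_nhdsLT hf h0 htop).eventually
    (eventually_le_integratedCount h), hpow] with s hs hp
  have hR := (isGreatest_zeroRadius hf h0 s).1
  have hR1 := zeroRadius_lt_one hf h0 htop s
  have hmono : ρ ≤ zeroRadius f s := zeroRadius_mono hf h0 (Nat.zero_le s)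
  set r := zeroRadius f s
  have hI := integratedCount_le hf h0 hR0.1 hmono hR1 (by simpa using hR0.2.2) hR.2.2
  have hpos : 0 < 1 - r ^ 2 := by nlinarith [hR.1]
  have h1 : ρ ^ (4 * (s : ℝ)) ≤ 1 - r ^ 2 := by
    rw [rpow_def_of_pos hR0.1, ← le_log_iff_exp_le hpos]
    nlinarith [hs.1]
  have h2 : ρ ^ ((5 : ℝ) * (s : ℝ)) = ρ ^ (4 * (s : ℝ)) * ρ ^ s := by
    rw [← rpow_natCast, ← rpow_add hR0.1]
    ring_nf
  have h3 : 0 < ρ ^ (4 * (s : ℝ)) := rpow_pos_of_pos hR0.1 _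
  rw [h2]
  nlinarith [hR.1]

/-- With `τ = 1 - R_s`, the lower bound for the integrated count between `1 - τ/2` and `1 - τ/4`
gives `s τ / 4 ≤ I(1 - τ/4) ≤ log (4 / τ)`, which forces `τ ≤ 4 log s / s`. -/
theorem eventually_one_sub_zeroRadius_le (hf : AnalyticOnNhd ℂ f (ball 0 1)) (h0 : f 0 ≠ 0)
    (h : Tendsto (fun r => integratedCount f r / -log (1 - r ^ 2)) (𝓝[<] 1) (𝓝 (1 / 2))) :
    ∀ᶠ s : ℕ in atTop, 1 - zeroRadius f s ≤ 4 * (log (s : ℝ) / (s : ℝ)) := by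
  have htop := zeroCount_one_eq_top hf h0 h
  have hlim : Tendsto (fun s => 1 - (1 - zeroRadius f s) / 4) atTop (𝓝[<] 1) := by
    refine tendsto_nhdsWithin_iff.2 ⟨?_, Eventually.of_forall fun s => ?_⟩
    · simpa using (((tendsto_zeroRadius hf h0).const_sub 1).div_const 4).const_sub 1
    · have := zeroRadius_lt_one hf h0 htop s
      simp only [Set.mem_Iio]
      linarith
  filter_upwards [hlim.eventually (eventually_le_integratedCount h), eventually_ge_atTop 3]
    with s hs hs3
  have hR := (isGreatest_zeroRadius hf h0 s)
  have hR1 := zeroRadius_lt_one hf h0 htop s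
  have hR0 := hR.1.1
  set τ := 1 - zeroRadius f s with hτ
  have hτ0 : 0 < τ := by linarith
  have hτ1 : τ < 1 := by linarith
  -- The radius `1 - τ/2` exceeds `R_s`, so maximality of `R_s` applies.
  have hN : (s : ℕ∞) ≤ zeroCount f (1 - τ / 2) := by
    by_contra hlt
    have := hR.2 ⟨by linarith, by linarith, (not_le.1 hlt).le⟩
    linarith
  have hI := le_integratedCount hf h0 (ρ := 1 - τ / 2) (r := 1 - τ / 4) (by linarith) (by linarith)
    (by linarith) hN
  have hlog : -log (1 - (1 - τ / 4) ^ 2) ≤ log (4 / τ) := by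
    rw [← log_inv]
    refine log_le_log (inv_pos.2 (by nlinarith)) ?_
    rw [inv_le_comm₀ (by nlinarith) (by positivity), inv_div]
    nlinarith
  have hs0 : (3 : ℝ) ≤ s := by exact_mod_cast hs3
  have hls : 1 ≤ log s := by
    rw [le_log_iff_exp_le (by linarith)]
    linarith [exp_one_lt_d9]
  by_contra hcon
  rw [not_le] at hcon
  -- Uses `log s ≥ 1`, the reason for `s ≥ 3`; it turns `log (4 / τ)` into at most `log s`.
  have h1 : 4 / s ≤ τ := by
    refine le_trans ?_ hcon.le
    rw [mul_div_assoc']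
    gcongr
    linarith
  have h2 : log (4 / τ) ≤ log s := by
    refine log_le_log (by positivity) ?_
    rw [div_le_comm₀ hτ0 (by linarith)]
    exact h1
  have h3 : s * τ ≤ 4 * log s := by nlinarith [hs.2]
  rw [← mul_div_assoc, div_lt_iff₀ (by linarith)] at hcon
  linarith

end Deterministic

end RandomSeries

namespace RandomSeries

/-! ### Characteristic functions and concentration of weighted sums -/

section Concentration

open Real

variable {Ω : Type*} [MeasurableSpace Ω] {P : Measure Ω} [IsProbabilityMeasure P]

theorem integral_cos_mul_sub {X : Ω → ℝ} (hX : Measurable X) (t α : ℝ) :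
    ∫ ω, cos (t * X ω - α) ∂P
      = (Complex.exp (-α * Complex.I) * charFun (P.map X) t).re := by
  rw [charFun_apply_real, integral_map hX.aemeasurable (by fun_prop),
    ← integral_const_mul]
  have hint : Integrable (fun ω => Complex.exp (-α * Complex.I) *
      Complex.exp (t * X ω * Complex.I)) P := by
    refine Integrable.of_bound (C := 1) (by fun_prop) (ae_of_all _ fun ω => ?_)
    rw [← Complex.exp_add]
    have : -(α : ℂ) * Complex.I + t * X ω * Complex.I
        = ((t * X ω - α : ℝ) : ℂ) * Complex.I := by push_cast; ring
    rw [this, Complex.norm_exp_ofReal_mul_I]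
  rw [← RCLike.re_eq_complex_re, ← integral_re hint]
  refine integral_congr_ae (ae_of_all _ fun ω => ?_)
  simp only [RCLike.re_eq_complex_re]
  rw [← Complex.exp_add]
  have : -(α : ℂ) * Complex.I + t * X ω * Complex.I
      = ((t * X ω - α : ℝ) : ℂ) * Complex.I := by push_cast; ring
  rw [this, Complex.exp_ofReal_mul_I_re]

/-- Up to `π` this is the quadratic bound `cos y ≤ 1 - 2 y^2 / π^2` with `π^2 ≤ 10`; on the
remaining range the cosine is nonpositive. -/
theorem cos_le_one_sub_sq_div_five {y η : ℝ} (h0 : 0 ≤ η) (hη : η ≤ |y|) (hη1 : η ≤ 1)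
    (hy : |y| ≤ π + 1) : cos y ≤ 1 - η ^ 2 / 5 := by
  rcases le_or_gt |y| π with h | h
  · have h1 := cos_le_one_sub_mul_cos_sq h
    have hpi : π ^ 2 ≤ 10 := by nlinarith [pi_lt_d2, pi_pos]
    have h2 : 1 / 5 ≤ 2 / π ^ 2 := by
      rw [div_le_div_iff₀ (by norm_num) (by positivity)]; linarith
    have h3 : η ^ 2 ≤ y ^ 2 := by rw [← sq_abs y]; gcongr
    nlinarith [sq_nonneg η]
  · have := cos_nonpos_of_pi_div_two_le_of_le (x := |y|) (by linarith [pi_pos])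
      (by linarith [pi_gt_three])
    rw [cos_abs] at this
    nlinarith

/-- Decay of the characteristic function near the origin for a random variable with unit second
moment and bounded concentration. -/
theorem norm_charFun_le_exp {X : Ω → ℝ} (hX : Measurable X) (h2 : ∫ ω, X ω ^ 2 ∂P = 1) {K : ℝ}
    (hK : 1 ≤ K) (hc : ∀ x ε : ℝ, 0 < ε → P.real {ω | |X ω - x| < ε} ≤ K * ε) {t : ℝ}
    (ht : |t| ≤ 1 / 4) : ‖charFun (P.map X) t‖ ≤ exp (-(t ^ 2 / (50 * K ^ 2))) := by
  have := Measure.isProbabilityMeasure_map (μ := P) hX.aemeasurable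
  rcases eq_or_ne t 0 with rfl | ht0
  · simp
  set φ := charFun (P.map X) t with hφ
  set α := φ.arg
  have hnorm : ‖φ‖ = ∫ ω, cos (t * X ω - α) ∂P := by
    rw [integral_cos_mul_sub hX]
    have h : Complex.exp (-α * Complex.I) * φ = ‖φ‖ := by
      conv_lhs => rw [← Complex.norm_mul_exp_arg_mul_I φ]
      rw [mul_left_comm, ← Complex.exp_add]
      simp [α]
    rw [h, Complex.ofReal_re]
  have htp : 0 < |t| := abs_pos.2 ht0
  have hX2 : Integrable (fun ω => X ω ^ 2) P := integrable_of_integral_eq_one h2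
  -- `|φ|` is the mean of `cos (t X - α)`, which is near `1` when `X` is near `α / t`. The width
  -- makes this event have probability at most `1/2`.
  set A : Set Ω := {ω | |X ω - α / t| < 1 / (2 * K)} with hA
  have hAm : MeasurableSet A := measurableSet_lt (by fun_prop) measurable_const
  have hPA : P.real A ≤ 1 / 2 := by
    refine (hc _ _ (by positivity)).trans_eq ?_
    field_simp
  set η := |t| / (2 * K) with hη
  have hη0 : 0 ≤ η := by positivity
  have hη1 : η ≤ 1 := by
    rw [hη, div_le_one (by positivity)]; linarith
  -- The term `X^2 / 16` discards `|X| ≥ 4`. For `|X| < 4` the argument is at most `π + 1`, so other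
  -- peaks of the cosine are not reached. In the mean a gain of `1 - 1/2 - 1/16 = 7/16` remains.
  have hpt : ∀ ω, cos (t * X ω - α) ≤
      1 - η ^ 2 / 5 * (1 - A.indicator (fun _ => (1 : ℝ)) ω - X ω ^ 2 / 16) := by
    intro ω
    by_cases hω : ω ∈ A
    · rw [Set.indicator_of_mem hω]
      have h1 : 0 ≤ η ^ 2 / 5 * (X ω ^ 2 / 16) := by positivity
      linarith [cos_le_one (t * X ω - α)]
    · rw [Set.indicator_of_notMem hω]
      rcases le_or_gt 4 |X ω| with h4 | h4
      · have h1 : 16 ≤ X ω ^ 2 := by rw [← sq_abs]; nlinarith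
        have h3 : 0 ≤ η ^ 2 / 5 * (X ω ^ 2 / 16 - 1) := by
          apply mul_nonneg (by positivity); linarith
        linarith [cos_le_one (t * X ω - α)]
      · have h1 : η ≤ |t * X ω - α| := by
          have : t * X ω - α = t * (X ω - α / t) := by field_simp
          rw [this, abs_mul, hη, div_eq_mul_one_div]
          simp only [hA, Set.mem_ofPred_eq, not_lt] at hω
          gcongr
        have h3 : |t * X ω - α| ≤ π + 1 := by
          have ha : |α| ≤ π := Complex.abs_arg_le_pi φ
          have hb : |t * X ω| ≤ 1 := by
            rw [abs_mul]; nlinarith [abs_nonneg (X ω)]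
          linarith [abs_sub (t * X ω) α]
        have h4 := cos_le_one_sub_sq_div_five hη0 h1 hη1 h3
        have h5 : 0 ≤ η ^ 2 / 5 * (X ω ^ 2 / 16) := by positivity
        linarith
  have hI0 : Integrable (fun ω => 1 - A.indicator (fun _ => (1 : ℝ)) ω) P :=
    (integrable_const 1).sub ((integrable_const 1).indicator hAm)
  have hI1 : Integrable (fun ω => 1 - A.indicator (fun _ => (1 : ℝ)) ω - X ω ^ 2 / 16) P :=
    hI0.sub (hX2.div_const 16)
  have hval : ∫ ω, 1 - A.indicator (fun _ => (1 : ℝ)) ω - X ω ^ 2 / 16 ∂P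
      = 1 - P.real A - 1 / 16 := by
    rw [integral_sub hI0 (hX2.div_const 16), integral_sub (integrable_const 1) ((integrable_const 1).indicator hAm),
      integral_div, h2, integral_indicator_const _ hAm]
    simp
  have hle : ‖φ‖ ≤ 1 - η ^ 2 / 5 * (1 - P.real A - 1 / 16) := by
    rw [hnorm, ← hval]
    calc ∫ ω, cos (t * X ω - α) ∂P
        ≤ ∫ ω, 1 - η ^ 2 / 5 * (1 - A.indicator (fun _ => (1 : ℝ)) ω - X ω ^ 2 / 16) ∂P := by
          refine integral_mono ?_ ((integrable_const 1).sub (hI1.const_mul _)) hpt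
          refine Integrable.of_bound (C := 1) (by fun_prop) (ae_of_all _ fun ω => ?_)
          exact abs_cos_le_one _
      _ = _ := by
          rw [integral_sub (integrable_const 1) (hI1.const_mul _), integral_const_mul]
          simp
  have hη2 : η ^ 2 = t ^ 2 / (4 * K ^ 2) := by rw [hη, div_pow, sq_abs]; ring
  have hfin : ‖φ‖ ≤ -(t ^ 2 / (50 * K ^ 2)) + 1 := by
    have h1 : η ^ 2 / 5 * (7 / 16) ≤ η ^ 2 / 5 * (1 - P.real A - 1 / 16) := by
      gcongr; linarith
    have h2 : t ^ 2 / (50 * K ^ 2) ≤ η ^ 2 / 5 * (7 / 16) := by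
      rw [hη2]
      have : t ^ 2 / (50 * K ^ 2) = t ^ 2 / (4 * K ^ 2) * (4 / 50) := by field_simp
      rw [this]
      have : 0 ≤ t ^ 2 / (4 * K ^ 2) := by positivity
      nlinarith
    linarith
  exact hfin.trans (add_one_le_exp _)

/-- For `x ≠ 0` the integral is the Fejér-type kernel `(1 - cos x) / x^2`. Four times it dominates
the indicator of `|x| ≤ 1`, which is what Esseen's inequality needs. -/
theorem integral_one_sub_mul_cos_nonneg (x : ℝ) :
    0 ≤ ∫ t in (0 : ℝ)..1, (1 - t) * cos (t * x) := by
  rcases eq_or_ne x 0 with rfl | hx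
  · refine intervalIntegral.integral_nonneg zero_le_one fun t ht => ?_
    simp [ht.2]
  · have hd : ∀ t ∈ Set.uIcc (0 : ℝ) 1,
        HasDerivAt (fun t => (1 - t) * (sin (t * x) / x) - cos (t * x) / x ^ 2)
          ((1 - t) * cos (t * x)) t := by
      intro t _
      have h0 : HasDerivAt (fun t => t * x) x t := by simpa using (hasDerivAt_id t).mul_const x
      have h1 : HasDerivAt (fun t : ℝ => 1 - t) (-1) t := by
        simpa using (hasDerivAt_id t).const_sub 1
      have h2 := (h1.mul (h0.sin.div_const x)).sub (h0.cos.div_const (x ^ 2))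
      refine h2.congr_deriv ?_
      field_simp
      ring
    rw [intervalIntegral.integral_eq_sub_of_hasDerivAt hd
      (Continuous.intervalIntegrable (by fun_prop) _ _)]
    have : (1 - 1) * (sin (1 * x) / x) - cos (1 * x) / x ^ 2
        - ((1 - 0) * (sin (0 * x) / x) - cos (0 * x) / x ^ 2) = (1 - cos x) / x ^ 2 := by
      simp; ring
    rw [this]
    have := cos_le_one x
    exact div_nonneg (by linarith) (sq_nonneg x)

theorem le_integral_one_sub_mul_cos {x : ℝ} (hx : |x| ≤ 1) :
    1 / 4 ≤ ∫ t in (0 : ℝ)..1, (1 - t) * cos (t * x) := by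
  have h1 : ∫ t in (0 : ℝ)..1, (1 - t) * (1 / 2) = 1 / 4 := by
    rw [intervalIntegral.integral_mul_const, intervalIntegral.integral_sub (by simp) (by simp)]
    norm_num
  rw [← h1]
  refine intervalIntegral.integral_mono_on zero_le_one
    (Continuous.intervalIntegrable (by fun_prop) _ _)
    (Continuous.intervalIntegrable (by fun_prop) _ _) fun t ht => ?_
  have ht' : 0 ≤ 1 - t := by linarith [ht.2]
  refine mul_le_mul_of_nonneg_left ?_ ht'
  have h2 := one_sub_sq_div_two_le_cos (x := t * x)
  have h3 : (t * x) ^ 2 ≤ 1 := by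
    rw [← sq_abs, abs_mul, abs_of_nonneg ht.1]
    have : t * |x| ≤ 1 := by nlinarith [ht.2, ht.1, abs_nonneg x]
    have h0 : 0 ≤ t * |x| := mul_nonneg ht.1 (abs_nonneg x)
    nlinarith
  linarith

/-- **Esseen's inequality** for the concentration around the origin. -/
theorem measureReal_abs_lt_le_integral_charFun {S : Ω → ℝ} (hS : Measurable S) {u : ℝ}
    (hu : 0 < u) :
    P.real {ω | |S ω| < u} ≤ 4 * ∫ t in (0 : ℝ)..1, ‖charFun (P.map S) (t / u)‖ := by
  have := Measure.isProbabilityMeasure_map (μ := P) hS.aemeasurable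
  set g : Ω → ℝ := fun ω => ∫ t in (0 : ℝ)..1, (1 - t) * cos (t * (S ω / u)) with hg
  have hprod : Integrable (fun p : ℝ × Ω => (1 - p.1) * cos (p.1 * (S p.2 / u)))
      ((volume.restrict (Set.Ioc 0 1)).prod P) := by
    refine Integrable.of_bound (C := 1) (by fun_prop) ?_
    have h1 : ∀ᵐ p : ℝ × Ω ∂(volume.restrict (Set.Ioc (0 : ℝ) 1)).prod P, p.1 ∈ Set.Ioc (0 : ℝ) 1 :=
      Measure.quasiMeasurePreserving_fst.ae (ae_restrict_mem measurableSet_Ioc)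
    filter_upwards [h1] with p hp
    rw [norm_mul, norm_eq_abs, norm_eq_abs, abs_of_nonneg (by linarith [hp.2])]
    have := abs_cos_le_one (p.1 * (S p.2 / u))
    nlinarith [hp.1, abs_nonneg (cos (p.1 * (S p.2 / u))), hp.2]
  have hgI : Integrable g P := by
    have := hprod.integral_prod_right
    simpa only [hg, intervalIntegral.integral_of_le zero_le_one] using this
  have h1 : P.real {ω | |S ω| < u} ≤ 4 * ∫ ω, g ω ∂P := by
    have hm : MeasurableSet {ω | |S ω| < u} := measurableSet_lt (by fun_prop) measurable_const
    rw [← integral_const_mul, ← integral_indicator_one hm]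
    refine integral_mono ((integrable_const (1 : ℝ)).indicator hm) (hgI.const_mul 4) fun ω => ?_
    by_cases hω : ω ∈ {ω | |S ω| < u}
    · rw [Set.indicator_of_mem hω]
      have : |S ω / u| ≤ 1 := by
        rw [abs_div, abs_of_pos hu, div_le_one hu]; exact le_of_lt hω
      have := le_integral_one_sub_mul_cos this
      simp only [hg, Pi.one_apply]
      linarith
    · rw [Set.indicator_of_notMem hω]
      have := integral_one_sub_mul_cos_nonneg (S ω / u)
      simp only [hg]
      linarith
  refine h1.trans (mul_le_mul_of_nonneg_left ?_ (by norm_num))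
  have hswap : ∫ ω, g ω ∂P = ∫ t in (0 : ℝ)..1, (1 - t) * ∫ ω, cos (t / u * S ω - 0) ∂P := by
    simp only [hg, intervalIntegral.integral_of_le zero_le_one]
    rw [← integral_integral_swap hprod]
    refine integral_congr_ae (ae_of_all _ fun t => ?_)
    simp only
    rw [← integral_const_mul]
    refine integral_congr_ae (ae_of_all _ fun ω => ?_)
    simp only
    congr 2
    ring
  have hcont : Continuous (charFun (P.map S)) := continuous_charFun
  rw [hswap]
  have heq : ∀ t : ℝ, ∫ ω, cos (t / u * S ω - 0) ∂P = (charFun (P.map S) (t / u)).re := fun t => by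
    rw [integral_cos_mul_sub hS]; simp
  simp only [heq]
  refine intervalIntegral.integral_mono_on zero_le_one
    (Continuous.intervalIntegrable (by fun_prop) _ _)
    (Continuous.intervalIntegrable (by fun_prop) _ _) fun t ht => ?_
  have h2 := Complex.abs_re_le_norm (charFun (P.map S) (t / u))
  calc (1 - t) * (charFun (P.map S) (t / u)).re
      ≤ (1 - t) * ‖charFun (P.map S) (t / u)‖ :=
        mul_le_mul_of_nonneg_left ((le_abs_self _).trans h2) (by linarith [ht.2])
    _ ≤ 1 * ‖charFun (P.map S) (t / u)‖ :=
        mul_le_mul_of_nonneg_right (by linarith [ht.1]) (norm_nonneg _)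
    _ = _ := one_mul _

variable {a : ℕ → Ω → ℝ} {K : ℝ}

theorem norm_charFun_sum_le_exp (ha : ∀ j, Measurable (a j)) (hind : iIndepFun a P)
    (h2 : ∀ j, ∫ ω, a j ω ^ 2 ∂P = 1) (hK : 1 ≤ K)
    (hc : ∀ j, ∀ x ε : ℝ, 0 < ε → P.real {ω | |a j ω - x| < ε} ≤ K * ε) (b : ℕ → ℝ)
    (hb : ∀ j, |b j| ≤ 1) (n : ℕ) {t : ℝ} (ht : |t| ≤ 1 / 4) :
    ‖charFun (P.map fun ω => ∑ j ∈ Finset.range n, b j * a j ω) t‖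
      ≤ exp (-((∑ j ∈ Finset.range n, b j ^ 2) * t ^ 2 / (50 * K ^ 2))) := by
  have hind' : iIndepFun (fun j ω => b j * a j ω) P :=
    hind.comp (fun j x => b j * x) fun j => by fun_prop
  have e : (fun ω => ∑ j ∈ Finset.range n, b j * a j ω)
      = ∑ j ∈ Finset.range n, fun ω => b j * a j ω := by ext; simp
  rw [e, iIndepFun.charFun_map_finsetSum_eq_prod (X := fun j ω => b j * a j ω)
    (fun j _ => by fun_prop) (hind'.restrict _), Finset.prod_apply, norm_prod, Finset.sum_mul, Finset.sum_div,
    ← Finset.sum_neg_distrib, exp_sum]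
  refine Finset.prod_le_prod (fun j _ => norm_nonneg _) fun j _ => ?_
  have hscale : charFun (P.map fun ω => b j * a j ω) t = charFun (P.map (a j)) (b j * t) := by
    rw [charFun_apply_real, charFun_apply_real, integral_map (by fun_prop) (by fun_prop),
      integral_map (by fun_prop) (by fun_prop)]
    refine integral_congr_ae (ae_of_all _ fun ω => ?_)
    simp only
    push_cast
    ring_nf
  rw [hscale]
  refine (norm_charFun_le_exp (ha j) (h2 j) hK (hc j) ?_).trans_eq ?_
  · rw [abs_mul]
    nlinarith [hb j, abs_nonneg t, abs_nonneg (b j)]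
  · congr 1
    ring

/-- Esseen's inequality with a Gaussian bound for the characteristic function. The condition `4 ≤ u`
keeps the frequencies `t / u` in the range `|t| ≤ 1/4` where that bound holds. -/
theorem measureReal_abs_sum_lt_le (ha : ∀ j, Measurable (a j)) (hind : iIndepFun a P)
    (h2 : ∀ j, ∫ ω, a j ω ^ 2 ∂P = 1) (hK : 1 ≤ K)
    (hc : ∀ j, ∀ x ε : ℝ, 0 < ε → P.real {ω | |a j ω - x| < ε} ≤ K * ε) {b : ℕ → ℝ}
    (hb : ∀ j, |b j| ≤ 1) {n : ℕ} {σ : ℝ} (hσ : 0 < σ)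
    (hσb : σ ^ 2 ≤ ∑ j ∈ Finset.range n, b j ^ 2) {u : ℝ} (hu : 4 ≤ u) :
    P.real {ω | |∑ j ∈ Finset.range n, b j * a j ω| < u} ≤ 26 * K * u / σ := by
  have hu0 : 0 < u := by linarith
  have hS : Measurable fun ω => ∑ j ∈ Finset.range n, b j * a j ω := by fun_prop
  have := Measure.isProbabilityMeasure_map (μ := P) hS.aemeasurable
  refine (measureReal_abs_lt_le_integral_charFun hS hu0).trans ?_
  have hcont : Continuous (charFun (P.map fun ω => ∑ j ∈ Finset.range n, b j * a j ω)) :=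
    continuous_charFun
  set A := σ ^ 2 / (50 * K ^ 2 * u ^ 2) with hA
  have hA0 : 0 < A := by positivity
  have h1 : ∫ t in (0 : ℝ)..1, ‖charFun (P.map fun ω => ∑ j ∈ Finset.range n, b j * a j ω) (t / u)‖
      ≤ ∫ t in (0 : ℝ)..1, exp (-A * t ^ 2) := by
    refine intervalIntegral.integral_mono_on zero_le_one
      (Continuous.intervalIntegrable (by fun_prop) _ _)
      (Continuous.intervalIntegrable (by fun_prop) _ _) fun t ht => ?_
    refine (norm_charFun_sum_le_exp ha hind h2 hK hc b hb n ?_).trans ?_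
    · rw [abs_div, abs_of_pos hu0, abs_of_nonneg ht.1, div_le_div_iff₀ hu0 (by norm_num)]
      linarith [ht.2]
    · rw [exp_le_exp, neg_mul, neg_le_neg_iff]
      have e : A * t ^ 2 = σ ^ 2 * (t / u) ^ 2 / (50 * K ^ 2) := by
        rw [hA]; field_simp
      rw [e]
      gcongr
  have h3 : ∫ t in (0 : ℝ)..1, exp (-A * t ^ 2) ≤ √(π / A) / 2 := by
    rw [← integral_gaussian_Ioi, intervalIntegral.integral_of_le zero_le_one]
    refine setIntegral_mono_set (integrable_exp_neg_mul_sq hA0).integrableOn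
      (ae_of_all _ fun t => (exp_pos _).le) (Set.Ioc_subset_Ioi_self.eventuallyLE)
  -- `50 π < 169 = 13^2`.
  have h4 : √(π / A) ≤ 13 * K * u / σ := by
    rw [sqrt_le_left (by positivity), hA]
    have : π / (σ ^ 2 / (50 * K ^ 2 * u ^ 2)) = 50 * π * (K * u / σ) ^ 2 := by field_simp
    rw [this]
    have : (13 * K * u / σ) ^ 2 = 169 * (K * u / σ) ^ 2 := by ring
    rw [this]
    gcongr
    linarith [pi_lt_d2]
  have h5 : 26 * K * u / σ = 2 * (13 * K * u / σ) := by ring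
  linarith

/-- Adding an independent summand does not increase the concentration. -/
theorem measureReal_abs_add_lt_le {X Y : Ω → ℝ} (hX : Measurable X) (hY : Measurable Y)
    (hind : IndepFun Y X P) (hK : 0 ≤ K)
    (hc : ∀ x ε : ℝ, 0 < ε → P.real {ω | |X ω - x| < ε} ≤ K * ε) {u : ℝ} (hu : 0 < u) :
    P.real {ω | |Y ω + X ω| < u} ≤ K * u := by
  have hm : MeasurableSet {p : ℝ × ℝ | |p.1 + p.2| < u} :=
    measurableSet_lt (by fun_prop) measurable_const
  have := Measure.isProbabilityMeasure_map (μ := P) hX.aemeasurable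
  have := Measure.isProbabilityMeasure_map (μ := P) hY.aemeasurable
  have h1 : P {ω | |Y ω + X ω| < u} ≤ ENNReal.ofReal (K * u) := by
    have e : {ω | |Y ω + X ω| < u} = (fun ω => (Y ω, X ω)) ⁻¹' {p : ℝ × ℝ | |p.1 + p.2| < u} := rfl
    rw [e, ← Measure.map_apply (by fun_prop) hm,
      (indepFun_iff_map_prod_eq_prod_map_map hY.aemeasurable hX.aemeasurable).1 hind,
      Measure.prod_apply hm]
    calc ∫⁻ y, (P.map X) (Prod.mk y ⁻¹' {p : ℝ × ℝ | |p.1 + p.2| < u}) ∂(P.map Y)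
        ≤ ∫⁻ _, ENNReal.ofReal (K * u) ∂(P.map Y) := by
          refine lintegral_mono fun y => ?_
          rw [Measure.map_apply hX (measurable_prodMk_left hm)]
          have e2 : X ⁻¹' (Prod.mk y ⁻¹' {p : ℝ × ℝ | |p.1 + p.2| < u})
              = {ω | |X ω - (-y)| < u} := by
            ext ω; simp [add_comm]
          rw [e2, ← ofReal_measureReal]
          exact ENNReal.ofReal_le_ofReal (hc _ _ hu)
      _ = ENNReal.ofReal (K * u) := by simp
  exact ENNReal.toReal_le_of_le_ofReal (by positivity) h1

/-- Valid at every scale: all terms but `a 0` form an independent summand, which cannot increase the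
concentration. -/
theorem measureReal_abs_sum_lt_le_mul (ha : ∀ j, Measurable (a j)) (hind : iIndepFun a P)
    (hK : 0 ≤ K) (hc : ∀ j, ∀ x ε : ℝ, 0 < ε → P.real {ω | |a j ω - x| < ε} ≤ K * ε) {b : ℕ → ℝ}
    (hb : b 0 = 1) {n : ℕ} (hn : 0 < n) {u : ℝ} (hu : 0 < u) :
    P.real {ω | |∑ j ∈ Finset.range n, b j * a j ω| < u} ≤ K * u := by
  have hind' : iIndepFun (fun j ω => b j * a j ω) P :=
    hind.comp (fun j x => b j * x) fun j => by fun_prop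
  have h := hind'.indepFun_finsetSum_of_notMem (fun j => by fun_prop)
    (s := (Finset.range n).erase 0) (i := 0) (by simp)
  have hm : Measurable (∑ j ∈ (Finset.range n).erase 0, fun ω => b j * a j ω) := by
    rw [Finset.sum_fn]
    fun_prop
  have := measureReal_abs_add_lt_le (X := fun ω => b 0 * a 0 ω) (by fun_prop)
    hm h hK (by simpa [hb] using hc 0) hu
  convert this using 4 with ω
  rw [← Finset.sum_erase_add _ _ (Finset.mem_range.2 hn)]
  simp

end Concentration

end RandomSeries

namespace RandomSeries

/-! ### Deterministic facts on power series -/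

section PowerSeries

open Metric

variable {b : ℕ → ℝ}

theorem summable_of_tsum_sq_ne_top
    (h : ∑' j : ℕ, ENNReal.ofReal (b j ^ 2 / ((j : ℝ) + 1) ^ 2) ≠ ⊤) {z : ℂ} (hz : ‖z‖ < 1) :
    Summable fun j : ℕ => (b j : ℂ) * z ^ j := by
  have hs : Summable fun j : ℕ => b j ^ 2 / ((j : ℝ) + 1) ^ 2 :=
    (summable_congr fun j => ENNReal.toReal_ofReal (by positivity)).1 (ENNReal.summable_toReal h)
  have hev : ∀ᶠ j : ℕ in atTop, b j ^ 2 / ((j : ℝ) + 1) ^ 2 < 1 :=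
    hs.tendsto_atTop_zero.eventually (gt_mem_nhds one_pos)
  have hgeo : Summable fun j : ℕ => ((j : ℝ) + 1) * ‖z‖ ^ j := by
    have h1 := summable_pow_mul_geometric_of_norm_lt_one (R := ℝ) 1 (r := ‖z‖) (by simpa using hz)
    have h2 := summable_geometric_of_lt_one (norm_nonneg z) hz
    refine (h1.add h2).congr fun j => ?_
    ring
  refine Summable.of_norm_bounded_eventually_nat hgeo ?_
  filter_upwards [hev] with j hj
  rw [norm_mul, norm_pow, Complex.norm_real, Real.norm_eq_abs]
  rw [div_lt_one (by positivity)] at hj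
  have := (abs_lt_of_sq_lt_sq hj (by positivity)).le
  gcongr

theorem analyticOnNhd_seriesSum
    (h : ∀ z : ℂ, ‖z‖ < 1 → Summable fun j : ℕ => (b j : ℂ) * z ^ j) :
    AnalyticOnNhd ℂ (seriesSum b) (ball 0 1) := by
  refine DifferentiableOn.analyticOnNhd (fun z hz => ?_) isOpen_ball
  obtain ⟨r, hzr, hr1⟩ := exists_between (mem_ball_zero_iff.1 hz)
  have hr0 : 0 ≤ r := (norm_nonneg z).trans hzr.le
  have hd : DifferentiableOn ℂ (seriesSum b) (ball 0 r) := by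
    refine Complex.differentiableOn_tsum_of_summable_norm
      (h (r : ℂ) (by rwa [Complex.norm_real, Real.norm_of_nonneg hr0])).norm
      (fun j => by fun_prop) isOpen_ball fun j w hw => ?_
    rw [norm_mul, norm_mul, norm_pow, norm_pow, Complex.norm_real r, Real.norm_of_nonneg hr0]
    gcongr
    exact (mem_ball_zero_iff.1 hw).le
  exact (hd.differentiableAt (isOpen_ball.mem_nhds (mem_ball_zero_iff.2 hzr))).differentiableWithinAt

theorem seriesSum_zero (b : ℕ → ℝ) : seriesSum b 0 = b 0 := by
  rw [seriesSum, tsum_eq_single 0 fun j hj => by simp [hj]]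
  simp

theorem hasSum_re_pow_sq {w : ℂ} (hw : ‖w‖ < 1) :
    HasSum (fun j : ℕ => (w ^ j).re ^ 2)
      ((1 - ‖w‖ ^ 2)⁻¹ / 2 + ((1 - w ^ 2)⁻¹).re / 2) := by
  have h1 : HasSum (fun j : ℕ => (‖w‖ ^ 2) ^ j) (1 - ‖w‖ ^ 2)⁻¹ :=
    hasSum_geometric_of_lt_one (by positivity) (by nlinarith [norm_nonneg w])
  have h2 : HasSum (fun j : ℕ => (w ^ 2) ^ j) (1 - w ^ 2)⁻¹ :=
    hasSum_geometric_of_norm_lt_one (by rw [norm_pow]; nlinarith [norm_nonneg w])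
  have e : (fun j : ℕ => (w ^ j).re ^ 2)
      = fun j : ℕ => (‖w‖ ^ 2) ^ j / 2 + ((w ^ 2) ^ j).re / 2 := by
    ext j
    rw [← pow_mul, ← pow_mul, mul_comm 2 j, pow_mul, pow_mul, ← norm_pow,
      ← Complex.normSq_eq_norm_sq, Complex.normSq_apply, sq (w ^ j), Complex.mul_re]
    ring
  rw [e]
  exact (h1.div_const 2).add ((Complex.hasSum_re h2).div_const 2)

/-- The full sum is at least `1 / (2 (1 - |w|^2))`, because `1 / (1 - w^2)` has nonnegative real
part; partial sums eventually pass half of that. So the real part of `f(w)` alone carries enough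
variance in every direction. -/
theorem eventually_le_sum_re_pow_sq {w : ℂ} (hw : ‖w‖ < 1) :
    ∀ᶠ n : ℕ in atTop, (1 / (2 * √(1 - ‖w‖ ^ 2))) ^ 2 ≤
      ∑ j ∈ Finset.range n, (w ^ j).re ^ 2 := by
  have hpos : 0 < 1 - ‖w‖ ^ 2 := by nlinarith [norm_nonneg w]
  refine ((hasSum_re_pow_sq hw).tendsto_sum_nat.eventually (lt_mem_nhds ?_)).mono fun n h => h.le
  rw [div_pow, mul_pow, Real.sq_sqrt hpos.le]
  have h1 : 0 ≤ ((1 - w ^ 2)⁻¹).re := by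
    rw [Complex.inv_re]
    refine div_nonneg ?_ (Complex.normSq_nonneg _)
    have h2 := Complex.abs_re_le_norm (w ^ 2)
    rw [norm_pow] at h2
    rw [Complex.sub_re, Complex.one_re]
    linarith [le_abs_self (w ^ 2).re]
  have h3 : 0 < (1 - ‖w‖ ^ 2)⁻¹ := inv_pos.2 hpos
  have h4 : (1 : ℝ) ^ 2 / (2 ^ 2 * (1 - ‖w‖ ^ 2)) = (1 - ‖w‖ ^ 2)⁻¹ / 4 := by field_simp; norm_num
  rw [h4]
  linarith

end PowerSeries

/-! ### Second moment of a logarithm from a small-ball bound -/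

section LogMoment

open Real

variable {Ω : Type*} [MeasurableSpace Ω] {P : Measure Ω} [IsProbabilityMeasure P]

/-- As `|T| < u` is an open condition, it holds for all late `S n` as soon as it holds in the limit;
continuity from below then passes the bound on. -/
theorem measureReal_abs_lt_le_of_tendsto {S : ℕ → Ω → ℝ} {T : Ω → ℝ}
    (h : ∀ᵐ ω ∂P, Tendsto (fun n => S n ω) atTop (𝓝 (T ω))) {u B : ℝ} (hB : 0 ≤ B)
    (hb : ∀ᶠ n in atTop, P.real {ω | |S n ω| < u} ≤ B) : P.real {ω | |T ω| < u} ≤ B := by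
  refine ENNReal.toReal_le_of_le_ofReal hB ?_
  have hmono : Monotone fun N : ℕ => {ω | ∀ n ≥ N, |S n ω| < u} :=
    fun N M hNM ω hω n hn => hω n (hNM.trans hn)
  calc P {ω | |T ω| < u} ≤ P (⋃ N : ℕ, {ω | ∀ n ≥ N, |S n ω| < u}) := by
        refine measure_mono_ae ?_
        filter_upwards [h] with ω hω hT
        obtain ⟨N, hN⟩ := eventually_atTop.1 (hω.abs.eventually (gt_mem_nhds hT))
        exact Set.mem_iUnion.2 ⟨N, hN⟩
    _ = ⨆ N : ℕ, P {ω | ∀ n ≥ N, |S n ω| < u} := hmono.measure_iUnion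
    _ ≤ ENNReal.ofReal B := by
        refine iSup_le fun N => ?_
        obtain ⟨n, hn, hnN⟩ := (hb.and (eventually_ge_atTop N)).exists
        refine (measure_mono (t := {ω | |S n ω| < u}) fun ω (hω : ∀ m ≥ N, |S m ω| < u) => hω n hnN).trans ?_
        rw [← ofReal_measureReal]
        exact ENNReal.ofReal_le_ofReal hn

/-- The bound for the second moment of the logarithm of a random variable, given a Hölder bound of
exponent `1 / 2` and constant `C` for its distribution near the origin. -/
noncomputable def logMomentBound (C : ℝ) : ENNReal :=
  1 + ∑' k : ℕ, ENNReal.ofReal (((k : ℝ) + 1) ^ 2 * (C * √(exp (1 - k))))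

theorem logMomentBound_ne_top (C : ℝ) : logMomentBound C ≠ ⊤ := by
  refine ENNReal.add_ne_top.2 ⟨ENNReal.one_ne_top, Summable.tsum_ofReal_ne_top ?_⟩
  have hr : ‖exp (-(1 / 2))‖ < 1 := by
    rw [norm_eq_abs, abs_of_pos (exp_pos _), exp_lt_one_iff]; norm_num
  have h1 := ((((summable_pow_mul_geometric_of_norm_lt_one (R := ℝ) 2 hr).add
    ((summable_pow_mul_geometric_of_norm_lt_one (R := ℝ) 1 hr).mul_left 2)).add
    (summable_pow_mul_geometric_of_norm_lt_one (R := ℝ) 0 hr))).mul_left (C * exp (1 / 2))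
  refine h1.congr fun k => ?_
  have e : √(exp (1 - k)) = exp (1 / 2) * exp (-(1 / 2)) ^ k := by
    rw [← exp_nat_mul, ← exp_add, ← exp_half]
    congr 1
    ring
  rw [e]
  ring

theorem ofReal_log_sq_le {y : ℝ} (hy : 0 ≤ y) :
    ENNReal.ofReal (log y ^ 2) ≤ ENNReal.ofReal (y ^ 2) +
      ∑' k : ℕ, {x : ℝ | x < exp (1 - k)}.indicator
        (fun _ => ENNReal.ofReal (((k : ℝ) + 1) ^ 2)) y := by
  rcases le_or_gt 1 y with h1 | h1
  · refine le_add_right (ENNReal.ofReal_le_ofReal ?_)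
    have := log_nonneg h1
    have := log_le_sub_one_of_pos (by linarith : 0 < y)
    gcongr
    linarith
  · rcases hy.eq_or_lt with rfl | h0
    · simp
    -- For `k = ⌊-log y⌋` one has only `y ≤ exp (-k)`; the threshold `exp (1 - k)` makes the
    -- inequality strict.
    · refine le_add_left (le_trans ?_ (ENNReal.le_tsum ⌊-log y⌋₊))
      have hl : 0 ≤ -log y := by linarith [log_nonpos hy h1.le]
      have hle := Nat.floor_le hl
      have hlt := Nat.lt_floor_add_one (-log y)
      rw [Set.indicator_of_mem]
      · refine ENNReal.ofReal_le_ofReal ?_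
        nlinarith
      · rw [Set.mem_ofPred_eq, ← log_lt_iff_lt_exp h0]
        linarith

theorem lintegral_log_sq_le {Y : Ω → ℝ} (hY : AEMeasurable Y P) (hY0 : ∀ ω, 0 ≤ Y ω)
    (hY2 : ∫⁻ ω, ENNReal.ofReal (Y ω ^ 2) ∂P ≤ 1) {C : ℝ}
    (hC : ∀ v : ℝ, 0 < v → P.real {ω | Y ω < v} ≤ C * √v) :
    ∫⁻ ω, ENNReal.ofReal (log (Y ω) ^ 2) ∂P ≤ logMomentBound C := by
  have hind : ∀ k : ℕ, AEMeasurable (fun ω => {x : ℝ | x < exp (1 - k)}.indicator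
      (fun _ => ENNReal.ofReal (((k : ℝ) + 1) ^ 2)) (Y ω)) P := fun k =>
    (measurable_const.indicator (measurableSet_lt measurable_id measurable_const)).comp_aemeasurable hY
  refine (lintegral_mono fun ω => ofReal_log_sq_le (hY0 ω)).trans ?_
  rw [lintegral_add_left' (by fun_prop), lintegral_tsum hind]
  refine add_le_add hY2 (ENNReal.tsum_le_tsum fun k => ?_)
  have e : (fun ω => {x : ℝ | x < exp (1 - k)}.indicator
      (fun _ => ENNReal.ofReal (((k : ℝ) + 1) ^ 2)) (Y ω)) =
      {ω | Y ω < exp (1 - k)}.indicator (fun _ => ENNReal.ofReal (((k : ℝ) + 1) ^ 2)) := rfl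
  rw [e, lintegral_indicator_const₀ (nullMeasurableSet_lt hY aemeasurable_const),
    ENNReal.ofReal_mul (by positivity), ← ofReal_measureReal]
  gcongr
  exact hC _ (exp_pos _)

end LogMoment

/-! ### Moments and small-ball probabilities of the random series -/

section RandomPowerSeries

open Real

variable {Ω : Type*} [MeasurableSpace Ω] {P : Measure Ω}
  {a : ℕ → Ω → ℝ} {K : ℝ}

/-- `∑ a_j^2 / (j+1)^2` has finite mean, so almost surely `a_j = O(j)`, which serves all `z` at
once. -/
theorem ae_summable (ha : ∀ j, Measurable (a j)) (h2 : ∀ j, ∫ ω, a j ω ^ 2 ∂P = 1) :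
    ∀ᵐ ω ∂P, ∀ z : ℂ, ‖z‖ < 1 → Summable fun j : ℕ => (a j ω : ℂ) * z ^ j := by
  have hfin : ∫⁻ ω, ∑' j : ℕ, ENNReal.ofReal (a j ω ^ 2 / ((j : ℝ) + 1) ^ 2) ∂P ≠ ⊤ := by
    rw [lintegral_tsum fun j => by fun_prop]
    have : ∀ j : ℕ, ∫⁻ ω, ENNReal.ofReal (a j ω ^ 2 / ((j : ℝ) + 1) ^ 2) ∂P
        = ENNReal.ofReal (1 / ((j : ℝ) + 1) ^ 2) := fun j => by
      rw [← ofReal_integral_eq_lintegral_ofReal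
        ((integrable_of_integral_eq_one (h2 j)).div_const _) (ae_of_all _ fun ω => by positivity),
        integral_div, h2]
    simp only [this]
    refine Summable.tsum_ofReal_ne_top ?_
    have := (summable_nat_add_iff 1).2 (summable_one_div_nat_pow.2 one_lt_two)
    exact_mod_cast this
  filter_upwards [ae_lt_top' (by fun_prop) hfin] with ω hω z hz
  exact summable_of_tsum_sq_ne_top hω.ne hz

theorem aemeasurable_seriesSum (ha : ∀ j, Measurable (a j))
    (hs : ∀ᵐ ω ∂P, ∀ z : ℂ, ‖z‖ < 1 → Summable fun j : ℕ => (a j ω : ℂ) * z ^ j) {w : ℂ}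
    (hw : ‖w‖ < 1) : AEMeasurable (fun ω => seriesSum (fun j => a j ω) w) P :=
  aemeasurable_of_tendsto_metrizable_ae' (f := fun n ω => ∑ j ∈ Finset.range n, (a j ω : ℂ) * w ^ j)
    (fun n => by fun_prop) (hs.mono fun ω hω => (hω w hw).hasSum.tendsto_sum_nat)

variable [IsProbabilityMeasure P]

theorem integral_sum_sq (ha : ∀ j, Measurable (a j)) (hind : iIndepFun a P)
    (h1 : ∀ j, ∫ ω, a j ω ∂P = 0) (h2 : ∀ j, ∫ ω, a j ω ^ 2 ∂P = 1) (b : ℕ → ℝ) (n : ℕ) :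
    Integrable (fun ω => (∑ j ∈ Finset.range n, b j * a j ω) ^ 2) P ∧
    ∫ ω, (∑ j ∈ Finset.range n, b j * a j ω) ^ 2 ∂P = ∑ j ∈ Finset.range n, b j ^ 2 := by
  have hind' : iIndepFun (fun j ω => b j * a j ω) P :=
    hind.comp (fun j x => b j * x) fun j => by fun_prop
  have hL : ∀ j, MemLp (a j) 2 P := fun j =>
    (memLp_two_iff_integrable_sq (ha j).aestronglyMeasurable).2
      (integrable_of_integral_eq_one (h2 j))
  have hL' : ∀ j, MemLp (fun ω => b j * a j ω) 2 P := fun j => (hL j).const_mul (b j)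
  have hLs : MemLp (fun ω => ∑ j ∈ Finset.range n, b j * a j ω) 2 P :=
    memLp_finsetSum _ fun j _ => hL' j
  refine ⟨hLs.integrable_sq, ?_⟩
  have hmean : ∫ ω, ∑ j ∈ Finset.range n, b j * a j ω ∂P = 0 := by
    rw [integral_finsetSum _ fun j _ => (hL' j).integrable (by norm_num)]
    simp [integral_const_mul, h1]
  rw [← variance_of_integral_eq_zero hLs.aemeasurable hmean]
  have e : (fun ω => ∑ j ∈ Finset.range n, b j * a j ω)
      = ∑ j ∈ Finset.range n, fun ω => b j * a j ω := by ext; simp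
  rw [e, IndepFun.variance_sum (X := fun j ω => b j * a j ω) (fun j _ => hL' j)
    fun i _ j _ hij => hind'.indepFun hij]
  refine Finset.sum_congr rfl fun j _ => ?_
  rw [variance_const_mul, variance_of_integral_eq_zero (ha j).aemeasurable (h1 j), h2, mul_one]

theorem lintegral_norm_sum_sq_le (ha : ∀ j, Measurable (a j)) (hind : iIndepFun a P)
    (h1 : ∀ j, ∫ ω, a j ω ∂P = 0) (h2 : ∀ j, ∫ ω, a j ω ^ 2 ∂P = 1) {w : ℂ} (hw : ‖w‖ < 1)
    (n : ℕ) : ∫⁻ ω, ENNReal.ofReal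
      ((√(1 - ‖w‖ ^ 2) * ‖∑ j ∈ Finset.range n, (a j ω : ℂ) * w ^ j‖) ^ 2) ∂P ≤ 1 := by
  have hpos : 0 < 1 - ‖w‖ ^ 2 := by nlinarith [norm_nonneg w]
  have hre := integral_sum_sq ha hind h1 h2 (fun j => (w ^ j).re) n
  have him := integral_sum_sq ha hind h1 h2 (fun j => (w ^ j).im) n
  have e : ∀ ω, (√(1 - ‖w‖ ^ 2) * ‖∑ j ∈ Finset.range n, (a j ω : ℂ) * w ^ j‖) ^ 2 =
      (1 - ‖w‖ ^ 2) * ((∑ j ∈ Finset.range n, (w ^ j).re * a j ω) ^ 2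
        + (∑ j ∈ Finset.range n, (w ^ j).im * a j ω) ^ 2) := fun ω => by
    rw [mul_pow, sq_sqrt hpos.le,
      ← Complex.normSq_eq_norm_sq (∑ j ∈ Finset.range n, (a j ω : ℂ) * w ^ j),
      Complex.normSq_apply, Complex.re_sum, Complex.im_sum]
    simp only [Complex.re_ofReal_mul, Complex.im_ofReal_mul, mul_comm (a _ ω), sq]
  simp only [e]
  have hint : Integrable (fun ω => (1 - ‖w‖ ^ 2) *
      ((∑ j ∈ Finset.range n, (w ^ j).re * a j ω) ^ 2
        + (∑ j ∈ Finset.range n, (w ^ j).im * a j ω) ^ 2)) P := (hre.1.add him.1).const_mul _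
  rw [← ofReal_integral_eq_lintegral_ofReal hint
    (ae_of_all _ fun ω => by positivity), integral_const_mul, integral_add hre.1 him.1, hre.2, him.2,
    ← Finset.sum_add_distrib, ENNReal.ofReal_le_one]
  have e2 : ∀ j, (w ^ j).re ^ 2 + (w ^ j).im ^ 2 = (‖w‖ ^ 2) ^ j := fun j => by
    rw [← pow_mul, mul_comm 2 j, pow_mul, ← norm_pow, ← Complex.normSq_eq_norm_sq,
      Complex.normSq_apply]
    ring
  simp only [e2]
  have h3 := geom_sum_mul (‖w‖ ^ 2) n
  have h4 : 0 ≤ (‖w‖ ^ 2) ^ n := by positivity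
  nlinarith

theorem lintegral_norm_seriesSum_sq_le (ha : ∀ j, Measurable (a j)) (hind : iIndepFun a P)
    (h1 : ∀ j, ∫ ω, a j ω ∂P = 0) (h2 : ∀ j, ∫ ω, a j ω ^ 2 ∂P = 1) {w : ℂ} (hw : ‖w‖ < 1) :
    ∫⁻ ω, ENNReal.ofReal ((√(1 - ‖w‖ ^ 2) * ‖seriesSum (fun j => a j ω) w‖) ^ 2) ∂P ≤ 1 := by
  calc _ ≤ ∫⁻ ω, liminf (fun n => ENNReal.ofReal
      ((√(1 - ‖w‖ ^ 2) * ‖∑ j ∈ Finset.range n, (a j ω : ℂ) * w ^ j‖) ^ 2)) atTop ∂P := by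
        refine lintegral_mono_ae ((ae_summable ha h2).mono fun ω hω => ?_)
        have := (hω w hw).hasSum.tendsto_sum_nat
        rw [(ENNReal.tendsto_ofReal ((this.norm.const_mul _).pow 2)).liminf_eq]
        rfl
    _ ≤ liminf (fun n => ∫⁻ ω, ENNReal.ofReal
      ((√(1 - ‖w‖ ^ 2) * ‖∑ j ∈ Finset.range n, (a j ω : ℂ) * w ^ j‖) ^ 2) ∂P) atTop :=
        lintegral_liminf_le fun n => by fun_prop
    _ ≤ 1 := by
        refine liminf_le_of_le (by isBoundedDefault) fun b hb => ?_
        obtain ⟨n, hn⟩ := hb.exists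
        exact hn.trans (lintegral_norm_sum_sq_le ha hind h1 h2 hw n)

/-- With `s = √(1 - |w|^2)` and `u = v / s`, the real part satisfies the bounds `52 K u s` for `u ≥
4` and `K u` always. Neither alone is uniform in `w` for all `v`; their combination is, at the price
of the exponent `1/2`. -/
theorem measureReal_norm_seriesSum_lt_le (ha : ∀ j, Measurable (a j)) (hind : iIndepFun a P)
    (h2 : ∀ j, ∫ ω, a j ω ^ 2 ∂P = 1) (hK : 1 ≤ K)
    (hc : ∀ j, ∀ x ε : ℝ, 0 < ε → P.real {ω | |a j ω - x| < ε} ≤ K * ε) {w : ℂ} (hw : ‖w‖ < 1)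
    {v : ℝ} (hv : 0 < v) :
    P.real {ω | √(1 - ‖w‖ ^ 2) * ‖seriesSum (fun j => a j ω) w‖ < v} ≤ 52 * K * √v := by
  have hpos : 0 < 1 - ‖w‖ ^ 2 := by nlinarith [norm_nonneg w]
  set s := √(1 - ‖w‖ ^ 2) with hs
  have hs0 : 0 < s := sqrt_pos.2 hpos
  have hb1 : ∀ j, |(w ^ j).re| ≤ 1 := fun j =>
    (Complex.abs_re_le_norm _).trans (by rw [norm_pow]; exact pow_le_one₀ (norm_nonneg w) hw.le)
  have hlim : ∀ᵐ ω ∂P, Tendsto (fun n => ∑ j ∈ Finset.range n, (w ^ j).re * a j ω) atTop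
      (𝓝 (seriesSum (fun j => a j ω) w).re) := by
    filter_upwards [ae_summable ha h2] with ω hω
    refine (Complex.hasSum_re (hω w hw).hasSum).tendsto_sum_nat.congr fun n => ?_
    exact Finset.sum_congr rfl fun j _ => by rw [Complex.re_ofReal_mul, mul_comm]
  have hbig : ∀ u : ℝ, 4 ≤ u → P.real {ω | |(seriesSum (fun j => a j ω) w).re| < u}
      ≤ 52 * K * u * s := fun u hu => by
    refine measureReal_abs_lt_le_of_tendsto hlim (by positivity) ?_
    filter_upwards [eventually_le_sum_re_pow_sq hw] with n hn
    refine (measureReal_abs_sum_lt_le ha hind h2 hK hc hb1 (σ := 1 / (2 * s)) (by positivity)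
      hn hu).trans_eq ?_
    field_simp
    norm_num
  have hsmall : ∀ u : ℝ, 0 < u → P.real {ω | |(seriesSum (fun j => a j ω) w).re| < u} ≤ K * u :=
    fun u hu => by
      refine measureReal_abs_lt_le_of_tendsto hlim (by positivity) ?_
      filter_upwards [eventually_gt_atTop 0] with n hn
      exact measureReal_abs_sum_lt_le_mul ha hind (by linarith) hc (by simp) hn hu
  have hsub : P.real {ω | s * ‖seriesSum (fun j => a j ω) w‖ < v}
      ≤ P.real {ω | |(seriesSum (fun j => a j ω) w).re| < v / s} := by
    refine measureReal_mono fun ω hω => ?_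
    rw [Set.mem_ofPred_eq, lt_div_iff₀ hs0, mul_comm]
    exact (mul_le_mul_of_nonneg_left (Complex.abs_re_le_norm _) hs0.le).trans_lt hω
  refine hsub.trans ?_
  have hsv : √v ^ 2 = v := sq_sqrt hv.le
  have hsv0 : 0 < √v := sqrt_pos.2 hv
  rcases le_or_gt 1 v with h1v | h1v
  · refine measureReal_le_one.trans ?_
    have : 1 ≤ √v := one_le_sqrt.2 h1v
    nlinarith
  have hsv1 : √v ≤ 1 := sqrt_le_one.2 h1v.le
  rcases le_or_gt 4 (v / s) with h | h
  · refine (hbig _ h).trans ?_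
    have : 52 * K * (v / s) * s = 52 * K * (√v * √v) := by rw [← sq, hsv]; field_simp
    rw [this]
    nlinarith [mul_nonneg hsv0.le (by linarith : 0 ≤ 1 - √v)]
  -- Here `u < 4`: multiplying `p ≤ K v / s` by the bound `p ≤ 208 K s` at scale `4` cancels `s`,
  -- and `208 ≤ 52^2`.
  · set p := P.real {ω | |(seriesSum (fun j => a j ω) w).re| < v / s}
    have hp0 : 0 ≤ p := measureReal_nonneg
    have hp1 : p ≤ K * (v / s) := hsmall _ (by positivity)
    have hp2 : p ≤ 208 * K * s :=
      (measureReal_mono fun ω hω => lt_trans hω h).trans ((hbig 4 le_rfl).trans_eq (by ring))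
    refine abs_le_of_sq_le_sq' ?_ (by positivity) |>.2
    calc p ^ 2 = p * p := sq p
      _ ≤ (K * (v / s)) * (208 * K * s) := mul_le_mul hp1 hp2 hp0 (by positivity)
      _ = 208 * K ^ 2 * v := by field_simp
      _ ≤ 52 ^ 2 * K ^ 2 * v := by gcongr; norm_num
      _ = (52 * K * √v) ^ 2 := by rw [mul_pow, mul_pow, hsv]

/-- The logarithm of the normalized modulus of a random power series has a second moment which is
bounded uniformly over the unit disc. -/
theorem lintegral_log_norm_seriesSum_sq_le (ha : ∀ j, Measurable (a j)) (hind : iIndepFun a P)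
    (h1 : ∀ j, ∫ ω, a j ω ∂P = 0) (h2 : ∀ j, ∫ ω, a j ω ^ 2 ∂P = 1) (hK : 1 ≤ K)
    (hc : ∀ j, ∀ x ε : ℝ, 0 < ε → P.real {ω | |a j ω - x| < ε} ≤ K * ε) {w : ℂ} (hw : ‖w‖ < 1) :
    ∫⁻ ω, ENNReal.ofReal
      ((log √(1 - ‖w‖ ^ 2) + log ‖seriesSum (fun j => a j ω) w‖) ^ 2) ∂P
      ≤ logMomentBound (52 * K) := by
  have hpos : 0 < 1 - ‖w‖ ^ 2 := by nlinarith [norm_nonneg w]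
  have hs0 : 0 < √(1 - ‖w‖ ^ 2) := sqrt_pos.2 hpos
  have hm := aemeasurable_seriesSum ha (ae_summable ha h2) hw
  have hC := fun v hv => measureReal_norm_seriesSum_lt_le ha hind h2 hK hc hw (v := v) hv
  -- Needed because, with `log 0 = 0`, the logarithm of the product splits only where `f(w) ≠ 0`.
  have hne : ∀ᵐ ω ∂P, seriesSum (fun j => a j ω) w ≠ 0 := by
    have hle : P.real {ω | seriesSum (fun j => a j ω) w = 0} ≤ 0 := by
      have hlim : Tendsto (fun v : ℝ => 52 * K * √v) (𝓝[>] 0) (𝓝 0) := by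
        have : Continuous fun v : ℝ => 52 * K * √v := by fun_prop
        simpa using (this.tendsto 0).mono_left nhdsWithin_le_nhds
      refine ge_of_tendsto hlim ?_
      filter_upwards [self_mem_nhdsWithin] with v hv
      refine (measureReal_mono fun ω hω => ?_).trans (hC v hv)
      rw [Set.mem_ofPred_eq] at hω ⊢
      rw [hω]
      simpa using hv
    have := le_antisymm hle measureReal_nonneg
    rw [measureReal_eq_zero_iff] at this
    rw [ae_iff]
    simpa using this
  refine le_trans (le_of_eq (lintegral_congr_ae ?_)) (lintegral_log_sq_le
    (Y := fun ω => √(1 - ‖w‖ ^ 2) * ‖seriesSum (fun j => a j ω) w‖) (hm.norm.const_mul _)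
    (fun ω => by positivity) (lintegral_norm_seriesSum_sq_le ha hind h1 h2 hw) hC)
  filter_upwards [hne] with ω hω
  rw [log_mul hs0.ne' (norm_ne_zero_iff.2 hω)]

end RandomPowerSeries

end RandomSeries

namespace RandomSeries

open Real

/-! ### From mean squares on circles to the integrated count -/

section CircleAverage

/-- The Cauchy-Schwarz inequality for averages over a circle. -/
theorem ofReal_sq_circleAverage_le {g : ℂ → ℝ} {r : ℝ} (hg : CircleIntegrable g 0 r) :
    ENNReal.ofReal (circleAverage g 0 r ^ 2)
      ≤ ∫⁻ θ in Set.Ioc 0 (2 * π), ENNReal.ofReal (g (circleMap 0 r θ) ^ 2) := by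
  have h2pi : 0 < 2 * π := by positivity
  set G : ℝ → ℝ := fun θ => g (circleMap 0 r θ) with hG
  set μ := volume.restrict (Set.Ioc 0 (2 * π)) with hμ
  have hGi : Integrable G μ := (intervalIntegrable_iff_integrableOn_Ioc_of_le h2pi.le).1 hg
  -- An infinite right-hand side is harmless, so square integrability need not be assumed. Otherwise
  -- nonnegativity of the variance gives the claim, with a factor `2 π` to spare.
  by_cases htop : ∫⁻ θ, ENNReal.ofReal (G θ ^ 2) ∂μ = ⊤
  · rw [htop]; exact le_top
  have hG2 : Integrable (fun θ => G θ ^ 2) μ :=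
    ⟨hGi.aestronglyMeasurable.pow 2, by
      rw [hasFiniteIntegral_iff_ofReal (ae_of_all _ fun θ => sq_nonneg _)]
      exact Ne.lt_top htop⟩
  rw [← ofReal_integral_eq_lintegral_ofReal hG2 (ae_of_all _ fun θ => sq_nonneg _)]
  refine ENNReal.ofReal_le_ofReal ?_
  set m := circleAverage g 0 r with hm
  have hmean : ∫ θ, G θ ∂μ = 2 * π * m := by
    rw [hm, circleAverage, intervalIntegral.integral_of_le h2pi.le, smul_eq_mul]
    field_simp
    rfl
  have hnn : 0 ≤ ∫ θ, (G θ - m) ^ 2 ∂μ := integral_nonneg fun θ => sq_nonneg _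
  have hexp : ∫ θ, (G θ - m) ^ 2 ∂μ = ∫ θ, G θ ^ 2 ∂μ - 2 * m * (2 * π * m) + m ^ 2 * (2 * π) := by
    have e : ∀ θ, (G θ - m) ^ 2 = G θ ^ 2 - 2 * m * G θ + m ^ 2 := fun θ => by ring
    simp only [e]
    have hi : Integrable (fun θ => G θ ^ 2 - 2 * m * G θ) μ := hG2.sub (hGi.const_mul _)
    rw [integral_add hi (integrable_const _), integral_sub hG2 (hGi.const_mul _),
      integral_const_mul, hmean, integral_const, hμ]
    simp [pi_pos.le, mul_comm]
  nlinarith [pi_gt_three, sq_nonneg m]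

/-- In Jensen's formula the normalization `log √(2^(-n)) = -n log 2 / 2` supplies the main term, and
Cauchy-Schwarz makes the normalized average `o(n)`. -/
theorem tendsto_integratedCount_of_tendsto_lintegral {f : ℂ → ℂ}
    (hf : AnalyticOnNhd ℂ f (Metric.ball 0 1)) (h0 : f 0 ≠ 0)
    (h : Tendsto (fun n : ℕ => ENNReal.ofReal (1 / ((n : ℝ) + 1) ^ 2) *
      ∫⁻ θ in Set.Ioc 0 (2 * π), ENNReal.ofReal
        ((log √((1 / 2) ^ n) + log ‖f (circleMap 0 √(1 - (1 / 2) ^ n) θ)‖) ^ 2)) atTop (𝓝 0)) :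
    Tendsto (fun r => integratedCount f r / -log (1 - r ^ 2)) (𝓝[<] 1) (𝓝 (1 / 2)) := by
  refine tendsto_integratedCount_div_of_sequence hf h0 ?_
  set r : ℕ → ℝ := fun n => √(1 - (1 / 2) ^ n) with hr
  set A : ℕ → ℝ := fun n => circleAverage (fun z => log √((1 / 2) ^ n) + log ‖f z‖) 0 (r n) with hA
  have hr1 : ∀ n, r n < 1 := fun n => by
    rw [hr, sqrt_lt' one_pos]
    have : (0 : ℝ) < (1 / 2) ^ n := by positivity
    linarith
  have hr0 : ∀ n, 0 ≤ r n := fun n => sqrt_nonneg _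
  have hci : ∀ n, CircleIntegrable (fun z => log ‖f z‖) 0 (r n) := fun n =>
    MeromorphicOn.circleIntegrable_log_norm fun z hz => by
      refine (hf z ?_).meromorphicAt
      rw [abs_of_nonneg (hr0 n)] at hz
      exact Metric.sphere_subset_closedBall.trans (Metric.closedBall_subset_ball (hr1 n)) hz
  have hA0 : Tendsto (fun n : ℕ => A n / ((n : ℝ) + 1)) atTop (𝓝 0) := by
    have h1 : Tendsto (fun n : ℕ => ENNReal.ofReal ((A n / ((n : ℝ) + 1)) ^ 2)) atTop (𝓝 0) := by
      refine tendsto_of_tendsto_of_tendsto_of_le_of_le tendsto_const_nhds h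
        (fun n => zero_le) fun n => ?_
      have e : (A n / ((n : ℝ) + 1)) ^ 2 = 1 / ((n : ℝ) + 1) ^ 2 * A n ^ 2 := by
        rw [div_pow]; ring
      simp only [e]
      rw [ENNReal.ofReal_mul (by positivity)]
      gcongr
      exact ofReal_sq_circleAverage_le ((circleIntegrable_const _ _ _).add (hci n))
    have h2 : Tendsto (fun n : ℕ => (A n / ((n : ℝ) + 1)) ^ 2) atTop (𝓝 0) := by
      have := (ENNReal.tendsto_toReal ENNReal.zero_ne_top).comp h1
      refine this.congr fun n => ?_
      exact ENNReal.toReal_ofReal (sq_nonneg _)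
    have h3 := h2.sqrt
    rw [sqrt_zero] at h3
    exact (tendsto_zero_iff_abs_tendsto_zero _).2 (h3.congr fun n => sqrt_sq_eq_abs _)
  -- The index `0` is left out because `r 0 = 0`.
  have hI : ∀ n : ℕ, 0 < n → integratedCount f (r n) = A n + n * (log 2 / 2) - log ‖f 0‖ := by
    intro n hn
    have hrn : 0 < r n := by
      rw [hr, sqrt_pos, sub_pos]
      exact pow_lt_one₀ (by norm_num) (by norm_num) (by omega)
    rw [(intervalIntegrable_and_integratedCount_eq hf h0 hrn (hr1 n)).2]
    have hAn : A n = log √((1 / 2) ^ n) + circleAverage (fun z => log ‖f z‖) 0 (r n) := by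
      have := circleAverage_add (circleIntegrable_const (log √((1 / 2) ^ n)) 0 (r n)) (hci n)
      rw [circleAverage_const] at this
      exact this
    have hl : log √((1 / 2 : ℝ) ^ n) = -(n * (log 2 / 2)) := by
      rw [log_sqrt (by positivity), log_pow, one_div, log_inv]
      ring
    rw [hAn, hl]
    ring
  have hlim := (hA0.mul ((tendsto_natCast_div_add_atTop (1 : ℝ)).inv₀ one_ne_zero)).add_const
    (log 2 / 2) |>.sub (tendsto_const_div_atTop_nhds_zero_nat (log ‖f 0‖))
  have e : 0 * (1 : ℝ)⁻¹ + log 2 / 2 - 0 = log 2 / 2 := by simp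
  rw [e] at hlim
  refine hlim.congr' ?_
  filter_upwards [eventually_gt_atTop 0] with n hn
  have hn' : (0 : ℝ) < n := by exact_mod_cast hn
  rw [hI n hn]
  field_simp

end CircleAverage

/-! ### Almost sure control along the sequence of radii -/

section AlmostSure

variable {Ω : Type*} [MeasurableSpace Ω] {P : Measure Ω}
  {a : ℕ → Ω → ℝ} {K : ℝ}

theorem aemeasurable_log_norm_seriesSum (ha : ∀ j, Measurable (a j))
    (hs : ∀ᵐ ω ∂P, ∀ z : ℂ, ‖z‖ < 1 → Summable fun j : ℕ => (a j ω : ℂ) * z ^ j) {r : ℝ}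
    (hr0 : 0 ≤ r) (hr1 : r < 1) (c : ℝ) :
    AEMeasurable (fun p : Ω × ℝ => ENNReal.ofReal
      ((c + log ‖seriesSum (fun j => a j p.1) (circleMap 0 r p.2)‖) ^ 2))
      (P.prod (volume.restrict (Set.Ioc 0 (2 * π)))) := by
  have h : AEMeasurable (fun p : Ω × ℝ => seriesSum (fun j => a j p.1) (circleMap 0 r p.2))
      (P.prod (volume.restrict (Set.Ioc 0 (2 * π)))) := by
    refine aemeasurable_of_tendsto_metrizable_ae' (f := fun n (p : Ω × ℝ) =>
      ∑ j ∈ Finset.range n, (a j p.1 : ℂ) * circleMap 0 r p.2 ^ j) (fun n => ?_) ?_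
    · have hc : Measurable (circleMap 0 r) := (continuous_circleMap 0 r).measurable
      fun_prop
    · filter_upwards [Measure.quasiMeasurePreserving_fst.ae hs] with p hp
      exact (hp _ (by rwa [norm_circleMap_zero, abs_of_nonneg hr0])).hasSum.tendsto_sum_nat
  exact ((measurable_log.comp_aemeasurable h.norm).const_add c |>.pow_const 2).ennreal_ofReal

/-- Replacing `K` by `max K 1` provides the condition `1 ≤ K` of the concentration estimates. -/
theorem measureReal_le_of_levyConcentration {X : Ω → ℝ}
    (hX : ∀ ε : ℝ, 0 < ε → levyConcentration P X ε ≤ ENNReal.ofReal (K * ε)) {x ε : ℝ}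
    (hε : 0 < ε) : P.real {ω | |X ω - x| < ε} ≤ max K 1 * ε := by
  refine ENNReal.toReal_le_of_le_ofReal (by positivity) ?_
  refine (le_iSup (fun t : ℝ => P {ω | |X ω - t| < ε}) x).trans ((hX ε hε).trans ?_)
  gcongr
  exact le_max_left K 1

variable [IsProbabilityMeasure P]

/-- By Tonelli and the uniform log moment, each circle integral has mean at most a constant
independent of `n`. The weighted series thus has finite mean, converges almost surely, and its terms
tend to `0`. -/
theorem ae_tendsto_lintegral (ha : ∀ j, Measurable (a j)) (hind : iIndepFun a P)
    (h1 : ∀ j, ∫ ω, a j ω ∂P = 0) (h2 : ∀ j, ∫ ω, a j ω ^ 2 ∂P = 1) (hK : 1 ≤ K)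
    (hc : ∀ j, ∀ x ε : ℝ, 0 < ε → P.real {ω | |a j ω - x| < ε} ≤ K * ε) :
    ∀ᵐ ω ∂P, Tendsto (fun n : ℕ => ENNReal.ofReal (1 / ((n : ℝ) + 1) ^ 2) *
      ∫⁻ θ in Set.Ioc 0 (2 * π), ENNReal.ofReal ((log √((1 / 2) ^ n) +
        log ‖seriesSum (fun j => a j ω) (circleMap 0 √(1 - (1 / 2) ^ n) θ)‖) ^ 2)) atTop (𝓝 0) := by
  have hr1 : ∀ n : ℕ, √(1 - (1 / 2 : ℝ) ^ n) < 1 := fun n => by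
    rw [sqrt_lt' one_pos]
    have : (0 : ℝ) < (1 / 2) ^ n := by positivity
    linarith
  have hjoint := fun n : ℕ => aemeasurable_log_norm_seriesSum (P := P) ha (ae_summable ha h2)
    (sqrt_nonneg (1 - (1 / 2 : ℝ) ^ n)) (hr1 n) (log √((1 / 2) ^ n))
  have hmeas : ∀ n : ℕ, AEMeasurable (fun ω => ∫⁻ θ in Set.Ioc 0 (2 * π), ENNReal.ofReal
      ((log √((1 / 2) ^ n) +
        log ‖seriesSum (fun j => a j ω) (circleMap 0 √(1 - (1 / 2) ^ n) θ)‖) ^ 2)) P :=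
    fun n => (hjoint n).lintegral_prod_right'
  have hbound : ∀ n : ℕ, ∫⁻ ω, (∫⁻ θ in Set.Ioc 0 (2 * π), ENNReal.ofReal
      ((log √((1 / 2) ^ n) +
        log ‖seriesSum (fun j => a j ω) (circleMap 0 √(1 - (1 / 2) ^ n) θ)‖) ^ 2)) ∂P
      ≤ logMomentBound (52 * K) * ENNReal.ofReal (2 * π) := fun n => by
    rw [lintegral_lintegral_swap (hjoint n)]
    calc _ ≤ ∫⁻ θ in Set.Ioc 0 (2 * π), logMomentBound (52 * K) := by
          refine lintegral_mono fun θ => ?_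
          have hn : ‖circleMap 0 √(1 - (1 / 2) ^ n) θ‖ = √(1 - (1 / 2) ^ n) := by
            rw [norm_circleMap_zero, abs_of_nonneg (sqrt_nonneg _)]
          have := lintegral_log_norm_seriesSum_sq_le ha hind h1 h2 hK hc
            (w := circleMap 0 √(1 - (1 / 2) ^ n) θ) (by rw [hn]; exact hr1 n)
          rw [hn, sq_sqrt (sub_nonneg.2 (pow_le_one₀ (by norm_num) (by norm_num))),
            sub_sub_cancel] at this
          exact this
      _ = _ := by rw [setLIntegral_const]; simp
  have hfin : ∫⁻ ω, (∑' n : ℕ, ENNReal.ofReal (1 / ((n : ℝ) + 1) ^ 2) *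
      ∫⁻ θ in Set.Ioc 0 (2 * π), ENNReal.ofReal ((log √((1 / 2) ^ n) +
        log ‖seriesSum (fun j => a j ω) (circleMap 0 √(1 - (1 / 2) ^ n) θ)‖) ^ 2)) ∂P ≠ ⊤ := by
    rw [lintegral_tsum fun n => (hmeas n).const_mul _]
    have hsum : ∑' n : ℕ, ENNReal.ofReal (1 / ((n : ℝ) + 1) ^ 2) ≠ ⊤ := by
      refine Summable.tsum_ofReal_ne_top ?_
      have := (summable_nat_add_iff 1).2 (summable_one_div_nat_pow.2 one_lt_two)
      exact_mod_cast this
    refine ne_top_of_le_ne_top (ENNReal.mul_ne_top hsum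
      (ENNReal.mul_ne_top (logMomentBound_ne_top (52 * K)) (ENNReal.ofReal_ne_top (r := 2 * π)))) ?_
    rw [← ENNReal.tsum_mul_right]
    refine ENNReal.tsum_le_tsum fun n => ?_
    rw [lintegral_const_mul'' _ (hmeas n)]
    gcongr
    exact hbound n
  filter_upwards [ae_lt_top' (AEMeasurable.tsum fun n => (hmeas n).const_mul _) hfin] with ω hω
  exact ENNReal.tendsto_atTop_zero_of_tsum_ne_top hω.ne

theorem ae_ne_zero_of_concentration {X : Ω → ℝ}
    (hc : ∀ x ε : ℝ, 0 < ε → P.real {ω | |X ω - x| < ε} ≤ K * ε) : ∀ᵐ ω ∂P, X ω ≠ 0 := by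
  have hle : P.real {ω | X ω = 0} ≤ 0 := by
    have hlim : Tendsto (fun v : ℝ => K * v) (𝓝[>] 0) (𝓝 0) := by
      have : Continuous fun v : ℝ => K * v := by fun_prop
      simpa using (this.tendsto 0).mono_left nhdsWithin_le_nhds
    refine ge_of_tendsto hlim ?_
    filter_upwards [self_mem_nhdsWithin] with v hv
    refine (measureReal_mono fun ω hω => ?_).trans (hc 0 v hv)
    rw [Set.mem_ofPred_eq] at hω ⊢
    rw [hω]
    simpa using hv
  have := le_antisymm hle measureReal_nonneg
  rw [measureReal_eq_zero_iff] at this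
  rw [ae_iff]
  simpa using this

end AlmostSure

end RandomSeries

theorem theorem4p5 :
    ∃ c C : ℝ, 0 < c ∧ 0 < C ∧
      ∀ (Ω : Type*) [MeasurableSpace Ω] (P : Measure Ω) [IsProbabilityMeasure P]
        (a : ℕ → Ω → ℝ) (K : ℝ),
        (∀ j, Measurable (a j)) →
        iIndepFun a P →
        (∀ j, ∫ ω, a j ω ∂P = 0) →
        (∀ j, ∫ ω, (a j ω) ^ 2 ∂P = 1) →
        (∀ j, ∀ ε : ℝ, 0 < ε →
          RandomSeries.levyConcentration P (a j) ε ≤ ENNReal.ofReal (K * ε)) →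
        ∀ᵐ ω ∂P, ∀ f : ℂ → ℂ, f = RandomSeries.seriesSum (fun j => a j ω) →
          -- the series converges in the open unit disc, and the quantities below are well defined
          (∀ z : ℂ, ‖z‖ < 1 → Summable fun j : ℕ => (a j ω : ℂ) * z ^ j) ∧
          (∀ r : ℝ, r < 1 → RandomSeries.zeroCount f r ≠ ⊤) ∧
          (∀ r : ℝ, 0 < r → r < 1 → IntervalIntegrable
            (fun t : ℝ => ((RandomSeries.zeroCount f t).toNat : ℝ) / t) volume 0 r) ∧
          (∀ s : ℕ, IsGreatest (RandomSeries.admissibleRadii f s)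
            (RandomSeries.zeroRadius f s)) ∧
          -- the first part
          liminf (fun r : ℝ => ((|1 / Real.log (1 - r ^ 2) * RandomSeries.integratedCount f r
            + 1 / 2| : ℝ) : EReal)) (𝓝[<] (1 : ℝ)) = 0 ∧
          -- the second part
          {z : ℂ | ‖z‖ < 1 ∧ f z = 0}.Infinite ∧
          (∀ s : ℕ, 0 < RandomSeries.zeroRadius f s ∧ RandomSeries.zeroRadius f s < 1) ∧
          Monotone (RandomSeries.zeroRadius f) ∧
          Tendsto (RandomSeries.zeroRadius f) atTop (𝓝 1) ∧
          (∀ᶠ s : ℕ in atTop, RandomSeries.zeroRadius f 0 ^ (c * (s : ℝ))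
            ≤ 1 - RandomSeries.zeroRadius f s) ∧
          (∀ᶠ s : ℕ in atTop, 1 - RandomSeries.zeroRadius f s
            ≤ C * (Real.log (s : ℝ) / (s : ℝ))) := by
  refine ⟨5, 4, by norm_num, by norm_num, ?_⟩
  intro Ω _ P _ a K ha hind h1 h2 hL
  have hc : ∀ j, ∀ x ε : ℝ, 0 < ε → P.real {ω | |a j ω - x| < ε} ≤ max K 1 * ε :=
    fun j x ε hε => RandomSeries.measureReal_le_of_levyConcentration (hL j) hε
  filter_upwards [RandomSeries.ae_summable ha h2, RandomSeries.ae_ne_zero_of_concentration (hc 0),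
    RandomSeries.ae_tendsto_lintegral ha hind h1 h2 (le_max_right K 1) hc] with ω hsum hne hlim
  rintro f rfl
  have hf := RandomSeries.analyticOnNhd_seriesSum hsum
  have h0 : RandomSeries.seriesSum (fun j => a j ω) 0 ≠ 0 := by
    rw [RandomSeries.seriesSum_zero]
    exact_mod_cast hne
  have hI := RandomSeries.tendsto_integratedCount_of_tendsto_lintegral hf h0 hlim
  have htop := RandomSeries.zeroCount_one_eq_top hf h0 hI
  exact ⟨hsum, fun r hr => RandomSeries.zeroCount_ne_top hf h0 hr,
    fun r hr0 hr1 => (RandomSeries.intervalIntegrable_and_integratedCount_eq hf h0 hr0 hr1).1,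
    RandomSeries.isGreatest_zeroRadius hf h0,
    RandomSeries.liminf_eq_zero_of_tendsto hI,
    RandomSeries.infinite_zeros hf h0 htop,
    fun s => ⟨(RandomSeries.isGreatest_zeroRadius hf h0 s).1.1,
      RandomSeries.zeroRadius_lt_one hf h0 htop s⟩,
    RandomSeries.zeroRadius_mono hf h0,
    RandomSeries.tendsto_zeroRadius hf h0,
    RandomSeries.eventually_rpow_le_one_sub_zeroRadius hf h0 hI,
    RandomSeries.eventually_one_sub_zeroRadius_le hf h0 hI⟩
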